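/- A smooth strictly convex closed plane curve means a smooth regular simple closed curve, parametrized by $S^1=\mathbb{R}/2\pi\mathbb{Z}$, that lies on one side of each of its tangent lines and whose curvature $k$ with respect to the inward unit normal $\mathbf{N}_{in}$ is positive everywhere. Its support function is $u(\theta)=\max_{\varphi}\langle X(\varphi),(\cos\theta,\sin\theta)\rangle$, where $\theta$ is the outward normal angle. Let $X_0:S^1\to\mathbb{R}^2$ be any parametrization of a smooth strictly convex closed plane curve. Then there are $T>0$ and a map $X:S^1\times[0,T)\to\mathbb{R}^2$, smooth on $S^1\times[0,T)$ (including $t=0$), such that $X(\cdot,t)$ parametrizes a smooth strictly convex closed curve for every $t\in[0,T)$ and $$\frac{\partial X}{\partial t}(\varphi,t)=\left[\frac{2A(t)}{L(t)}-\frac{1}{k(\varphi,t)}\right]\mathbf{N}_{in}(\varphi,t),\qquad X(\varphi,0)=X_0(\varphi),$$ where $L(t)$ and $A(t)$ are the length and the enclosed area of $X(\cdot,t)$, and $k(\varphi,t)$ and $\mathbf{N}_{in}(\varphi,t)$ are its curvature and inward unit normal at $X(\varphi,t)$. Moreover, the solution can be chosen such that the support function $u(\theta,t)$ of $X(\cdot,t)$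 is smooth on $S^1\times[0,T)$ and satisfies there $u_{\theta\theta}+u>0$, $\int_0^{2\pi}u\,d\theta>0$ and $$\frac{\partial u}{\partial t}=u_{\theta\theta}+u-\frac{\int_0^{2\pi}u\,(u_{\theta\theta}+u)\,d\theta}{\int_0^{2\pi}u\,d\theta},$$ and is given by the convergent Fourier series $$u(\theta,t)=\frac{a_0(t)}{2}+\sum_{n=1}^{\infty}e^{(1-n^2)t}\left(a_n\cos n\theta+b_n\sin n\theta\right),\qquad a_0(t)=\sqrt{a_0^2+2\sum_{n=1}^{\infty}\left(1-e^{2(1-n^2)t}\right)\left(a_n^2+b_n^2\right)},$$ where $a_n=\frac1\pi\int_0^{2\pi}u_0\cos n\theta\,d\theta$ and $b_n=\frac1\pi\int_0^{2\pi}u_0\sin n\theta\,d\theta$ are the Fourier coefficients of the support function $u_0$ of $X_0$. -/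

import Mathlib

open MeasureTheory Set
open scoped ContDiff RealInnerProductSpace

noncomputable section

namespace DualFlow

/-- The Euclidean plane. -/
abbrev Plane : Type := EuclideanSpace ℝ (Fin 2)

/-- Counterclockwise rotation by a right angle. -/
def rot (v : Plane) : Plane := !₂[-v 1, v 0]

/-- The unit vector with angle `θ`. -/
def dir (θ : ℝ) : Plane := !₂[Real.cos θ, Real.sin θ]

/-- The unit normal on the left of the direction of travel. -/
def leftNormal (γ : ℝ → Plane) (φ : ℝ) : Plane :=
  ‖deriv γ φ‖⁻¹ • rot (deriv γ φ)

open Classical in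
/-- The inward unit normal of a convex closed curve: of the two unit normals, the one that points
to the side of the tangent line on which the curve lies. Both orientations of the
parametrization are allowed. -/
def inwardNormal (γ : ℝ → Plane) (φ : ℝ) : Plane :=
  if ∀ ψ, 0 ≤ ⟪γ ψ - γ φ, leftNormal γ φ⟫ then leftNormal γ φ else -leftNormal γ φ

/-- The curvature with respect to the inward normal: for the arc length parameter `s` one has
`γ_ss = k N_in`, and `⟪γ_ss, N_in⟫ = ⟪γ_φφ, N_in⟫ / ‖γ_φ‖ ^ 2`. -/
def curvature (γ : ℝ → Plane) (φ : ℝ) : ℝ :=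
  ⟪deriv (deriv γ) φ, inwardNormal γ φ⟫ / ‖deriv γ φ‖ ^ 2

/-- The length of a curve with parameter in `ℝ / 2πℤ`. -/
def length (γ : ℝ → Plane) : ℝ :=
  ∫ φ in (0 : ℝ)..2 * Real.pi, ‖deriv γ φ‖

/-- The area enclosed by a convex closed curve; the closed region that the curve bounds is the
convex hull of its trace. -/
def area (γ : ℝ → Plane) : ℝ :=
  (volume (convexHull ℝ (range γ))).toReal

/-- A smooth strictly convex closed plane curve with parameter in `S¹ = ℝ / 2πℤ`: smooth, closed,
regular, simple, on one side of each of its tangent lines, with positive curvature. -/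
structure IsStrictlyConvexCurve (γ : ℝ → Plane) : Prop where
  smooth : ContDiff ℝ ∞ γ
  periodic : Function.Periodic γ (2 * Real.pi)
  regular : ∀ φ, deriv γ φ ≠ 0
  simple : InjOn γ (Ico 0 (2 * Real.pi))
  convex : ∀ φ, (∀ ψ, 0 ≤ ⟪γ ψ - γ φ, leftNormal γ φ⟫) ∨
    (∀ ψ, ⟪γ ψ - γ φ, leftNormal γ φ⟫ ≤ 0)
  curvature_pos : ∀ φ, 0 < curvature γ φ

/-- `X φ t`, for `0 ≤ t < T`, is a smooth strictly convex solution of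
`X_t = (2 A / L - 1 / k) N_in` with `X φ 0 = X₀ φ`. Smoothness is joint in `(φ, t)` and
includes `t = 0`, where the time derivative is one-sided. -/
structure IsSmoothConvexSolution (X₀ : ℝ → Plane) (T : ℝ) (X : ℝ → ℝ → Plane) : Prop where
  smooth : ContDiffOn ℝ ∞ (fun p : ℝ × ℝ => X p.1 p.2) (univ ×ˢ Ico 0 T)
  convex : ∀ t ∈ Ico 0 T, IsStrictlyConvexCurve (fun φ => X φ t)
  initial : ∀ φ, X φ 0 = X₀ φ
  flow : ∀ φ, ∀ t ∈ Ico 0 T,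
    HasDerivWithinAt (fun s => X φ s)
      ((2 * area (fun ψ => X ψ t) / length (fun ψ => X ψ t)
          - 1 / curvature (fun ψ => X ψ t) φ) • inwardNormal (fun ψ => X ψ t) φ)
      (Ico 0 T) t

/-- The support function of a closed curve, as a function of the outward normal angle. -/
def supportFun (γ : ℝ → Plane) (θ : ℝ) : ℝ := ⨆ φ, ⟪γ φ, dir θ⟫

/-- `u_θθ + u`. -/
def radius (u : ℝ → ℝ) (θ : ℝ) : ℝ := deriv (deriv u) θ + u θ

/-- `u θ t` is a smooth solution, `2π`-periodic in `θ` and with `u_θθ + u > 0`, of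
`u_t = u_θθ + u - (∫ u (u_θθ + u) dθ) / (∫ u dθ)` for `0 ≤ t < T`. -/
structure IsSupportSolution (T : ℝ) (u : ℝ → ℝ → ℝ) : Prop where
  smooth : ContDiffOn ℝ ∞ (fun p : ℝ × ℝ => u p.1 p.2) (univ ×ˢ Ico 0 T)
  periodic : ∀ t ∈ Ico 0 T, Function.Periodic (fun θ => u θ t) (2 * Real.pi)
  radius_pos : ∀ t ∈ Ico 0 T, ∀ θ, 0 < radius (fun α => u α t) θ
  integral_pos : ∀ t ∈ Ico 0 T, 0 < ∫ α in (0 : ℝ)..2 * Real.pi, u α t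
  equation : ∀ θ, ∀ t ∈ Ico 0 T,
    HasDerivWithinAt (fun s => u θ s)
      (radius (fun α => u α t) θ
        - (∫ α in (0 : ℝ)..2 * Real.pi, u α t * radius (fun β => u β t) α)
          / (∫ α in (0 : ℝ)..2 * Real.pi, u α t))
      (Ico 0 T) t

/-- Cosine Fourier coefficient. -/
def cosCoeff (f : ℝ → ℝ) (n : ℕ) : ℝ :=
  (1 / Real.pi) * ∫ θ in (0 : ℝ)..2 * Real.pi, f θ * Real.cos (n * θ)

/-- Sine Fourier coefficient. -/
def sinCoeff (f : ℝ → ℝ) (n : ℕ) : ℝ :=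
  (1 / Real.pi) * ∫ θ in (0 : ℝ)..2 * Real.pi, f θ * Real.sin (n * θ)

/-- `u θ t` is given for `0 ≤ t < T` by the convergent Fourier series
`a₀(t) / 2 + ∑_{n ≥ 1} e^{(1 - n²) t} (aₙ cos nθ + bₙ sin nθ)` with
`a₀(t) = √(a₀² + 2 ∑_{n ≥ 1} (1 - e^{2 (1 - n²) t}) (aₙ² + bₙ²))`, where `aₙ`, `bₙ` are the Fourier
coefficients of `u₀`. In the sums the index `n : ℕ` stands for `n + 1`. -/
def IsFourierSolution (u₀ : ℝ → ℝ) (T : ℝ) (u : ℝ → ℝ → ℝ) : Prop :=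
  ∀ t ∈ Ico 0 T, ∃ S : ℝ,
    HasSum (fun n : ℕ => (1 - Real.exp (2 * (1 - ((n : ℝ) + 1) ^ 2) * t)) *
      (cosCoeff u₀ (n + 1) ^ 2 + sinCoeff u₀ (n + 1) ^ 2)) S ∧
    ∀ θ, HasSum (fun n : ℕ => Real.exp ((1 - ((n : ℝ) + 1) ^ 2) * t) *
      (cosCoeff u₀ (n + 1) * Real.cos (((n : ℝ) + 1) * θ)
        + sinCoeff u₀ (n + 1) * Real.sin (((n : ℝ) + 1) * θ)))
      (u θ t - Real.sqrt (cosCoeff u₀ 0 ^ 2 + 2 * S) / 2)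

end DualFlow

end

/-! A strictly convex curve is governed by its support function `u`: the point with outward normal
`dir θ` is `point u θ`, its radius of curvature is `radius u = u'' + u`, and `L = ∫ u`, `2A = ∫ u *
radius u` (`length_curve`, `area_curve`). At fixed normal angle the flow reads `u_t = radius u -
2A/L`, which is linear up to a function of time alone.

Each Fourier mode of frequency `n ≥ 1` therefore evolves on its own with the factor `e^{(1-n²)t}`,
and only the mean feels the nonlocal term. If `w` is the oscillating part, the equation for the mean
says that `a₀² + (2/π) ∫ w²` is conserved, and Parseval turns this into the stated square root
(`hasDerivAt_supportSolution`, `isFourierSolution_supportSolution`). By continuity, `a₀²` and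
`radius u` stay positive for a short time.

It remains to recover a parametrized curve. Points with fixed normal angle also drift tangentially.
The drift disappears if the normal angle of each particle moves with speed `-ρ'/ρ`, where `ρ =
radius u` (`hasDerivAt_point_flow`). The smooth flow of this scalar equation (`exists_smooth_flow`),
applied to the normal angle of the initial curve (`IsStrictlyConvexCurve.exists_support`), gives the
parametrization. Everything is first extended smoothly to all real times, so that smoothness at `t =
0` needs no one-sided argument and the angle field is globally bounded. -/

open Filter Topology

namespace DualFlow

/-! ### Smooth dependence of integrals on parameters. -/

section ParametricIntegral

universe u

variable {E : Type u} [NormedAddCommGroup E] [NormedSpace ℝ E] [ProperSpace E]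

/-- Since `E` is proper, the partial derivative is bounded on the compact product of a unit ball and
the interval; this constant is the dominating function. -/
theorem hasFDerivAt_intervalIntegral {F : Type*} [NormedAddCommGroup F] [NormedSpace ℝ F]
    {f : E × ℝ → F} (hf : ContDiff ℝ 1 f) (a b : ℝ) (x : E) :
    HasFDerivAt (fun y => ∫ s in a..b, f (y, s))
      (∫ s in a..b, (fderiv ℝ f (x, s)).comp (ContinuousLinearMap.inl ℝ E ℝ)) x := by
  have hc : Continuous fun p : E × ℝ => (fderiv ℝ f p).comp (ContinuousLinearMap.inl ℝ E ℝ) :=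
    (hf.continuous_fderiv one_ne_zero).clm_comp continuous_const
  obtain ⟨C, hC⟩ := ((isCompact_closedBall x 1).prod (isCompact_uIcc (a := a) (b := b))).exists_bound_of_continuousOn
    hc.continuousOn
  refine (intervalIntegral.hasFDerivAt_integral_of_dominated_of_fderiv_le
    (F := fun y s => f (y, s))
    (F' := fun y s => (fderiv ℝ f (y, s)).comp (ContinuousLinearMap.inl ℝ E ℝ))
    (bound := fun _ => C) (Metric.closedBall_mem_nhds x one_pos) ?_ ?_ ?_ ?_ ?_ ?_)
  · refine Eventually.of_forall fun y => ?_
    exact (hf.continuous.comp (by fun_prop : Continuous fun s : ℝ => (y, s))).aestronglyMeasurable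
  · exact (hf.continuous.comp (by fun_prop : Continuous fun s : ℝ => (x, s))).intervalIntegrable _ _
  · exact (hc.comp (by fun_prop : Continuous fun s : ℝ => (x, s))).aestronglyMeasurable
  · refine Eventually.of_forall fun s hs y hy => hC (y, s) ⟨hy, uIoc_subset_uIcc hs⟩
  · exact intervalIntegrable_const
  · refine Eventually.of_forall fun s hs y hy => ?_
    have h1 : HasFDerivAt f (fderiv ℝ f (y, s)) (y, s) :=
      (hf.differentiable one_ne_zero).differentiableAt.hasFDerivAt
    exact h1.comp y (hasFDerivAt_prodMk_left y s)

/-- The induction replaces `F` by `E →L[ℝ] F`, so `F` is generalized and must live in the universe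
of `E`. -/
theorem contDiff_intervalIntegral_nat (n : ℕ) {F : Type u} [NormedAddCommGroup F]
    [NormedSpace ℝ F] {f : E × ℝ → F} (hf : ContDiff ℝ n f) (a b : ℝ) :
    ContDiff ℝ n (fun y => ∫ s in a..b, f (y, s)) := by
  induction n generalizing F with
  | zero =>
    rw [Nat.cast_zero, contDiff_zero] at hf ⊢
    exact intervalIntegral.continuous_parametric_intervalIntegral_of_continuous'
      (f := fun y s => f (y, s)) hf a b
  | succ n ih =>
    have h1 : ContDiff ℝ 1 f := hf.of_le (by norm_cast; omega)
    rw [Nat.cast_succ, contDiff_succ_iff_hasFDerivAt]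
    refine ⟨_, ih (f := fun p => (fderiv ℝ f p).comp (ContinuousLinearMap.inl ℝ E ℝ)) ?_,
      hasFDerivAt_intervalIntegral h1 a b⟩
    exact (hf.fderiv_right (m := n) (by norm_cast)).clm_comp contDiff_const

theorem contDiff_intervalIntegral {F : Type u} [NormedAddCommGroup F]
    [NormedSpace ℝ F] {f : E × ℝ → F} (hf : ContDiff ℝ ∞ f) (a b : ℝ) :
    ContDiff ℝ ∞ (fun y => ∫ s in a..b, f (y, s)) :=
  contDiff_infty.2 fun n => contDiff_intervalIntegral_nat n (contDiff_infty.1 hf n) a b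

/-- Rescaling the variable of integration makes the endpoints constant and moves the upper limit
into the integrand. -/
theorem contDiff_primitive (n : ℕ) {f : ℝ → ℝ → ℝ}
    (hf : ContDiff ℝ n (fun p : ℝ × ℝ => f p.1 p.2)) :
    ContDiff ℝ n (fun p : ℝ × ℝ => ∫ s in (0 : ℝ)..p.2, f p.1 s) := by
  have h : (fun p : ℝ × ℝ => ∫ s in (0 : ℝ)..p.2, f p.1 s)
      = fun p : ℝ × ℝ => p.2 * ∫ s in (0 : ℝ)..1, f p.1 (p.2 * s) := by
    funext p
    rw [intervalIntegral.mul_integral_comp_mul_left]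
    simp
  rw [h]
  refine contDiff_snd.mul (contDiff_intervalIntegral_nat n
    (f := fun q : (ℝ × ℝ) × ℝ => f q.1.1 (q.1.2 * q.2)) ?_ 0 1)
  exact hf.comp (contDiff_fst.fst.prodMk (contDiff_fst.snd.mul contDiff_snd))

end ParametricIntegral

/-! ### Partial derivatives of smooth functions of two real variables. -/

section Partial

variable {F : Type*} [NormedAddCommGroup F] [NormedSpace ℝ F] {f : ℝ → ℝ → F}

theorem hasDerivAt_fst (hf : ContDiff ℝ ∞ (fun p : ℝ × ℝ => f p.1 p.2)) (x t : ℝ) :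
    HasDerivAt (fun y => f y t) (fderiv ℝ (fun p : ℝ × ℝ => f p.1 p.2) (x, t) (1, 0)) x := by
  have h1 := (hf.differentiable (by simp)).differentiableAt (x := (x, t)) |>.hasFDerivAt
  have h2 : HasDerivAt (fun y : ℝ => (y, t)) ((1 : ℝ), (0 : ℝ)) x :=
    (hasDerivAt_id x).prodMk (hasDerivAt_const x t)
  exact h1.comp_hasDerivAt x h2

theorem hasDerivAt_snd (hf : ContDiff ℝ ∞ (fun p : ℝ × ℝ => f p.1 p.2)) (x t : ℝ) :
    HasDerivAt (fun s => f x s) (fderiv ℝ (fun p : ℝ × ℝ => f p.1 p.2) (x, t) (0, 1)) t := by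
  have h1 := (hf.differentiable (by simp)).differentiableAt (x := (x, t)) |>.hasFDerivAt
  have h2 : HasDerivAt (fun s : ℝ => (x, s)) ((0 : ℝ), (1 : ℝ)) t :=
    (hasDerivAt_const t x).prodMk (hasDerivAt_id t)
  exact h1.comp_hasDerivAt t h2

theorem contDiff_deriv_fst (hf : ContDiff ℝ ∞ (fun p : ℝ × ℝ => f p.1 p.2)) :
    ContDiff ℝ ∞ (fun p : ℝ × ℝ => deriv (fun y => f y p.2) p.1) := by
  have h : (fun p : ℝ × ℝ => deriv (fun y => f y p.2) p.1)
      = fun p => fderiv ℝ (fun p : ℝ × ℝ => f p.1 p.2) p (1, 0) :=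
    funext fun p => (hasDerivAt_fst hf p.1 p.2).deriv
  rw [h]
  exact (hf.fderiv_right (m := ∞) (by simp)).clm_apply contDiff_const

/-- Mixed partial derivatives of a smooth function commute. -/
theorem deriv_deriv_comm (hf : ContDiff ℝ ∞ (fun p : ℝ × ℝ => f p.1 p.2)) (x t : ℝ) :
    deriv (fun s => deriv (fun y => f y s) x) t = deriv (fun y => deriv (fun s => f y s) t) x := by
  set D := fderiv ℝ (fun p : ℝ × ℝ => f p.1 p.2) with hD
  have e1 : (fun s => deriv (fun y => f y s) x) = fun s => D (x, s) (1, 0) :=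
    funext fun s => (hasDerivAt_fst hf x s).deriv
  have e2 : (fun y => deriv (fun s => f y s) t) = fun y => D (y, t) (0, 1) :=
    funext fun y => (hasDerivAt_snd hf y t).deriv
  have hd : ContDiff ℝ ∞ D := hf.fderiv_right (m := ∞) (by simp)
  have hs : IsSymmSndFDerivAt ℝ (fun p : ℝ × ℝ => f p.1 p.2) (x, t) :=
    hf.contDiffAt.isSymmSndFDerivAt (by simpa using WithTop.coe_le_coe.2 (le_top : (2 : ℕ∞) ≤ ⊤))
  have hs' : fderiv ℝ D (x, t) (0, 1) (1, 0) = fderiv ℝ D (x, t) (1, 0) (0, 1) := hs.eq _ _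
  have k1 := hasDerivAt_snd (f := fun a b => D (a, b)) hd x t
  have k2 := hasDerivAt_fst (f := fun a b => D (a, b)) hd x t
  have l1 := ((ContinuousLinearMap.apply ℝ F ((1 : ℝ), (0 : ℝ))).hasFDerivAt.comp_hasDerivAt t k1)
  have l2 := ((ContinuousLinearMap.apply ℝ F ((0 : ℝ), (1 : ℝ))).hasFDerivAt.comp_hasDerivAt x k2)
  rw [e1, e2]
  exact (l1.deriv.trans hs').trans l2.deriv.symm

end Partial

/-! ### Smooth global flows of scalar time-dependent vector fields. -/

section Flow

open scoped NNReal

/-- With a global bound `M`, a Picard–Lindelöf ball of radius `M * (N + 1)` holds every solution up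
to time `N + 1`. Solutions on growing intervals agree by uniqueness and glue together. -/
theorem exists_global_solution {F : ℝ → ℝ → ℝ} {K M : ℝ≥0}
    (hc : Continuous (fun p : ℝ × ℝ => F p.1 p.2))
    (hK : ∀ t, LipschitzWith K (fun x => F x t)) (hM : ∀ x t, |F x t| ≤ M) (x : ℝ) :
    ∃ α : ℝ → ℝ, α 0 = x ∧ ∀ t, HasDerivAt α (F (α t) t) t := by
  have key : ∀ N : ℕ, ∃ α : ℝ → ℝ, α 0 = x ∧
      ∀ t ∈ Ioo (-((N : ℝ) + 1)) (N + 1), HasDerivAt α (F (α t) t) t := by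
    intro N
    have hN : (0 : ℝ) ∈ Icc (-((N : ℝ) + 1)) (N + 1) := ⟨by linarith [N.cast_nonneg (α := ℝ)], by positivity⟩
    have hPL : IsPicardLindelof (fun t x => F x t) (⟨0, hN⟩ : Icc (-((N : ℝ) + 1)) (N + 1)) x
        (M * (N + 1)) 0 M K := by
      refine ⟨fun t _ => (hK t).lipschitzOnWith, fun y _ => ?_, fun t _ y _ => hM y t, ?_⟩
      · exact (hc.comp (by fun_prop : Continuous fun t : ℝ => (y, t))).continuousOn
      · simp
    obtain ⟨α, h0, hα⟩ := hPL.exists_eq_forall_mem_Icc_hasDerivWithinAt₀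
    exact ⟨α, h0, fun t ht => (hα t (Ioo_subset_Icc_self ht)).hasDerivAt (Icc_mem_nhds ht.1 ht.2)⟩
  choose α h0 hα using key
  have huniq : ∀ m n : ℕ, m ≤ n → ∀ t ∈ Ioo (-((m : ℝ) + 1)) (m + 1), α m t = α n t := by
    intro m n hmn t ht
    have hmn' : (m : ℝ) ≤ n := by exact_mod_cast hmn
    refine ODE_solution_unique_of_mem_Ioo (v := fun t x => F x t) (s := fun _ => univ) (K := K)
      (t₀ := 0) (fun t _ => (hK t).lipschitzOnWith) ?_ (fun s hs => ⟨hα m s hs, trivial⟩)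
      (fun s hs => ⟨hα n s ⟨by linarith [hs.1], by linarith [hs.2]⟩, trivial⟩)
      ((h0 m).trans (h0 n).symm) ht
    exact ⟨by linarith [m.cast_nonneg (α := ℝ)], by positivity⟩
  have hmem : ∀ (t : ℝ) (n : ℕ), |t| ≤ n → t ∈ Ioo (-((n : ℝ) + 1)) (n + 1) := fun t n h =>
    ⟨by linarith [(abs_le.1 h).1], by linarith [(abs_le.1 h).2]⟩
  refine ⟨fun t => α ⌈|t|⌉₊ t, h0 _, fun t => ?_⟩
  -- The index used at time `s` varies with `s`; one index larger than needed at `t` serves a whole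
  -- neighbourhood of `t`.
  set n := ⌈|t|⌉₊ + 1 with hn
  have hloc : ∀ s : ℝ, |s| < n → α ⌈|s|⌉₊ s = α n s := fun s hs =>
    huniq _ _ (Nat.ceil_le.2 hs.le) s (hmem s _ (Nat.le_ceil _))
  have htn : |t| < n := by
    rw [hn]; push_cast; linarith [Nat.le_ceil |t|]
  have hev : (fun s => α ⌈|s|⌉₊ s) =ᶠ[𝓝 t] α n := by
    filter_upwards [(continuous_abs.tendsto t).eventually (gt_mem_nhds htn)] with s hs
    exact hloc s hs
  have := (hα n t (hmem t n htn.le)).congr_of_eventuallyEq hev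
  simpa only [hloc t htn] using this

/-- The average of `∂ₓ F` over the segment from `p` to `q`. -/
noncomputable def meanSlope (F : ℝ → ℝ → ℝ) (p q t : ℝ) : ℝ :=
  ∫ s in (0 : ℝ)..1, deriv (fun x => F x t) (p + s * (q - p))

variable {F : ℝ → ℝ → ℝ}

/-- Hadamard's lemma. It makes the difference of two trajectories solve a linear equation with
continuous coefficient. -/
theorem sub_eq_mul_meanSlope (hF : ContDiff ℝ ∞ (fun p : ℝ × ℝ => F p.1 p.2)) (p q t : ℝ) :
    F q t - F p t = (q - p) * meanSlope F p q t := by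
  have hd : ∀ x, HasDerivAt (fun x => F x t) (deriv (fun x => F x t) x) x := fun x =>
    (hasDerivAt_fst hF x t).differentiableAt.hasDerivAt
  have hcont : Continuous (fun x => deriv (fun x => F x t) x) :=
    (contDiff_deriv_fst hF).continuous.comp (by fun_prop : Continuous fun x : ℝ => (x, t))
  have h1 : ∀ s ∈ uIcc (0 : ℝ) 1, HasDerivAt (fun s => F (p + s * (q - p)) t)
      (deriv (fun x => F x t) (p + s * (q - p)) * (q - p)) s := by
    intro s _
    have h2 : HasDerivAt (fun s : ℝ => p + s * (q - p)) (q - p) s := by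
      simpa using ((hasDerivAt_id s).mul_const (q - p)).const_add p
    exact (hd _).comp s h2
  have h2 := intervalIntegral.integral_eq_sub_of_hasDerivAt h1
    (Continuous.intervalIntegrable (by fun_prop) _ _)
  rw [intervalIntegral.integral_mul_const] at h2
  rw [meanSlope, mul_comm, h2]
  simp

theorem meanSlope_self (p t : ℝ) : meanSlope F p p t = deriv (fun x => F x t) p := by
  simp [meanSlope]

theorem continuous_meanSlope (hF : ContDiff ℝ ∞ (fun p : ℝ × ℝ => F p.1 p.2)) :
    Continuous (fun z : ℝ × ℝ × ℝ => meanSlope F z.1 z.2.1 z.2.2) := by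
  refine intervalIntegral.continuous_parametric_intervalIntegral_of_continuous'
    (f := fun (z : ℝ × ℝ × ℝ) s =>
      deriv (fun x => F x z.2.2) (z.1 + s * (z.2.1 - z.1))) ?_ 0 1
  exact (contDiff_deriv_fst hF).continuous.comp (f := fun w : (ℝ × ℝ × ℝ) × ℝ =>
    (w.1.1 + w.2 * (w.1.2.1 - w.1.1), w.1.2.2)) (by fun_prop)

theorem abs_meanSlope_le {K : ℝ} (hK : ∀ x t, |deriv (fun y => F y t) x| ≤ K) (p q t : ℝ) :
    |meanSlope F p q t| ≤ K := by
  simpa [meanSlope] using intervalIntegral.norm_integral_le_of_norm_le_const (a := 0) (b := 1)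
    (f := fun s => deriv (fun x => F x t) (p + s * (q - p))) (C := K) (fun s _ => hK _ t)

/-- A solution of a linear scalar equation is an exponential. -/
theorem eq_mul_exp_integral {D g : ℝ → ℝ} (hg : Continuous g)
    (hD : ∀ t, HasDerivAt D (D t * g t) t) (t : ℝ) :
    D t = D 0 * Real.exp (∫ s in (0 : ℝ)..t, g s) := by
  have hI : ∀ t, HasDerivAt (fun t => ∫ s in (0 : ℝ)..t, g s) (g t) t := fun t =>
    intervalIntegral.integral_hasDerivAt_right (hg.intervalIntegrable _ _)
      (hg.stronglyMeasurableAtFilter _ _) hg.continuousAt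
  have h1 : ∀ t, HasDerivAt (fun t => D t * Real.exp (-∫ s in (0 : ℝ)..t, g s)) 0 t := by
    intro t
    convert! (hD t).mul (hI t).neg.exp using 1
    ring
  have h2 := is_const_of_deriv_eq_zero (fun t => (h1 t).differentiableAt)
    (fun t => (h1 t).deriv) t 0
  simp only [intervalIntegral.integral_same, neg_zero, Real.exp_zero, mul_one] at h2
  rw [← h2, mul_assoc, ← Real.exp_add]
  simp

/-- A smooth scalar vector field that is bounded together with its space derivative has a smooth
global flow, whose maps are increasing diffeomorphisms onto their images. -/
theorem exists_smooth_flow {K M : ℝ≥0} (hF : ContDiff ℝ ∞ (fun p : ℝ × ℝ => F p.1 p.2))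
    (hK : ∀ x t, |deriv (fun y => F y t) x| ≤ K) (hM : ∀ x t, |F x t| ≤ M) :
    ∃ Θ : ℝ → ℝ → ℝ, ContDiff ℝ ∞ (fun p : ℝ × ℝ => Θ p.1 p.2) ∧ (∀ x, Θ x 0 = x) ∧
      (∀ x t, HasDerivAt (fun s => Θ x s) (F (Θ x t) t) t) ∧
      (∀ x t, 0 < deriv (fun y => Θ y t) x) ∧
      ∀ x (α : ℝ → ℝ), α 0 = x → (∀ t, HasDerivAt α (F (α t) t) t) → α = Θ x := by
  have hLip : ∀ t, LipschitzWith K (fun x => F x t) := fun t =>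
    lipschitzWith_of_nnnorm_deriv_le (fun x => (hasDerivAt_fst hF x t).differentiableAt)
      (fun x => hK x t)
  choose Θ h0 hΘ using exists_global_solution hF.continuous hLip hM
  have hcx : ∀ x, Continuous (Θ x) := fun x =>
    continuous_iff_continuousAt.2 fun t => (hΘ x t).continuousAt
  have hgc : ∀ x y, Continuous (fun t => meanSlope F (Θ x t) (Θ y t) t) := fun x y =>
    (continuous_meanSlope hF).comp ((hcx x).prodMk ((hcx y).prodMk continuous_id))
  -- This exact formula does all the work: it yields Lipschitz dependence on the initial value,
  -- hence joint continuity, and letting `y → x` in the difference quotient yields the space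
  -- derivative.
  have hdiff : ∀ x y t, Θ y t - Θ x t
      = (y - x) * Real.exp (∫ s in (0 : ℝ)..t, meanSlope F (Θ x s) (Θ y s) s) := by
    intro x y t
    have := eq_mul_exp_integral (D := fun t => Θ y t - Θ x t) (hgc x y)
      (fun t => by
        rw [← sub_eq_mul_meanSlope hF]; exact (hΘ y t).sub (hΘ x t)) t
    simpa only [h0] using this
  have hbound : ∀ x y t, |Θ y t - Θ x t| ≤ |y - x| * Real.exp (K * |t|) := by
    intro x y t
    rw [hdiff, abs_mul, Real.abs_exp]
    refine mul_le_mul_of_nonneg_left (Real.exp_le_exp.2 ((le_abs_self _).trans ?_)) (abs_nonneg _)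
    simpa using intervalIntegral.norm_integral_le_of_norm_le_const (a := 0) (b := t)
      (f := fun s => meanSlope F (Θ x s) (Θ y s) s) (C := K) (fun s _ => abs_meanSlope_le hK _ _ _)
  have hcont : Continuous (fun p : ℝ × ℝ => Θ p.1 p.2) := by
    refine continuous_iff_continuousAt.2 fun ⟨x, t⟩ => ?_
    have h1 : Tendsto (fun p : ℝ × ℝ => |p.1 - x| * Real.exp (K * |p.2|) + |Θ x p.2 - Θ x t|)
        (𝓝 (x, t)) (𝓝 0) := by
      have : Continuous (fun p : ℝ × ℝ =>
        |p.1 - x| * Real.exp (K * |p.2|) + |Θ x p.2 - Θ x t|) := by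
        have := hcx x
        fun_prop
      simpa using this.tendsto (x, t)
    refine tendsto_iff_dist_tendsto_zero.2 (squeeze_zero (fun _ => dist_nonneg) (fun p => ?_) h1)
    rw [Real.dist_eq]
    calc |Θ p.1 p.2 - Θ x t| ≤ |Θ p.1 p.2 - Θ x p.2| + |Θ x p.2 - Θ x t| := abs_sub_le _ _ _
      _ ≤ _ := by gcongr; exact hbound _ _ _
  have hdx : ∀ x t, HasDerivAt (fun y => Θ y t)
      (Real.exp (∫ s in (0 : ℝ)..t, deriv (fun y => F y s) (Θ x s))) x := by
    intro x t
    have hE : Continuous (fun y => Real.exp (∫ s in (0 : ℝ)..t, meanSlope F (Θ x s) (Θ y s) s)) := by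
      refine Real.continuous_exp.comp
        (intervalIntegral.continuous_parametric_intervalIntegral_of_continuous'
          (f := fun y s => meanSlope F (Θ x s) (Θ y s) s) ?_ 0 t)
      exact (continuous_meanSlope hF).comp (f := fun p : ℝ × ℝ => (Θ x p.2, Θ p.1 p.2, p.2))
        (((hcx x).comp continuous_snd).prodMk (hcont.prodMk continuous_snd))
    rw [hasDerivAt_iff_tendsto_slope]
    have h1 := (hE.tendsto x).mono_left (nhdsWithin_le_nhds (s := {x}ᶜ))
    simp only [meanSlope_self] at h1
    refine h1.congr' ?_
    filter_upwards [self_mem_nhdsWithin] with y hy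
    have hne : y - x ≠ 0 := sub_ne_zero.2 hy
    rw [slope_def_field, hdiff x y t, mul_div_cancel_left₀ _ hne]
  -- Bootstrapping: both partial derivatives of `Θ` are smooth expressions in `Θ` and its primitives
  -- in time, so they are as regular as `Θ`, which is then one order better.
  have hsmooth : ∀ n : ℕ, ContDiff ℝ n (fun p : ℝ × ℝ => Θ p.1 p.2) := by
    intro n
    induction n with
    | zero => exact contDiff_zero.2 hcont
    | succ n ih =>
      have hG : ContDiff ℝ n (fun p : ℝ × ℝ => (Θ p.1 p.2, p.2)) := ih.prodMk contDiff_snd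
      have c1 : ContDiff ℝ n (fun p : ℝ × ℝ =>
          Real.exp (∫ s in (0 : ℝ)..p.2, deriv (fun y => F y s) (Θ p.1 s))) :=
        Real.contDiff_exp.comp (contDiff_primitive n
          (f := fun x s => deriv (fun y => F y s) (Θ x s))
          ((contDiff_infty.1 (contDiff_deriv_fst hF) n).comp hG))
      have c2 : ContDiff ℝ n (fun p : ℝ × ℝ => F (Θ p.1 p.2) p.2) :=
        (contDiff_infty.1 hF n).comp hG
      rw [Nat.cast_succ, contDiff_succ_iff_hasFDerivAt]
      let L := ContinuousLinearMap.toSpanSingletonLIE ℝ ℝ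
      let f₁ : ℝ → ℝ → ℝ →L[ℝ] ℝ := fun x t =>
        L (Real.exp (∫ s in (0 : ℝ)..t, deriv (fun y => F y s) (Θ x s)))
      let f₂ : ℝ → ℝ → ℝ →L[ℝ] ℝ := fun x t => L (F (Θ x t) t)
      have d1 : ContDiff ℝ n (fun p : ℝ × ℝ => f₁ p.1 p.2) := L.contDiff.comp c1
      have d2 : ContDiff ℝ n (fun p : ℝ × ℝ => f₂ p.1 p.2) := L.contDiff.comp c2
      refine ⟨fun p => (f₁ p.1 p.2).coprod (f₂ p.1 p.2), ?_, fun p => ?_⟩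
      · have : (fun p : ℝ × ℝ => (f₁ p.1 p.2).coprod (f₂ p.1 p.2)) = fun p =>
            (f₁ p.1 p.2).comp (ContinuousLinearMap.fst ℝ ℝ ℝ)
              + (f₂ p.1 p.2).comp (ContinuousLinearMap.snd ℝ ℝ ℝ) := by
          funext p; ext <;> simp
        rw [this]
        exact (d1.clm_comp contDiff_const).add (d2.clm_comp contDiff_const)
      · exact (hasStrictFDerivAt_uncurry_coprod (f := Θ) (f₁ := f₁) (f₂ := f₂)
          (Eventually.of_forall fun v => (hdx v.1 v.2).hasFDerivAt)
          (Eventually.of_forall fun v => (hΘ v.1 v.2).hasFDerivAt)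
          d1.continuous.continuousAt d2.continuous.continuousAt).hasFDerivAt
  refine ⟨Θ, contDiff_infty.2 hsmooth, h0, hΘ, fun x t => ?_, fun x α hα0 hα => ?_⟩
  · rw [(hdx x t).deriv]; exact Real.exp_pos _
  · exact ODE_solution_unique_univ (v := fun t x => F x t) (s := fun _ => univ) (K := K) (t₀ := 0)
      (fun t => (hLip t).lipschitzOnWith) (fun t => ⟨hα t, trivial⟩)
      (fun t => ⟨hΘ x t, trivial⟩) (hα0.trans (h0 x).symm)

end Flow

/-! ### The rotating frame `dir θ`, `rot (dir θ)` of the plane. -/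

section Plane

@[simp] theorem dir_zero_apply (θ : ℝ) : dir θ 0 = Real.cos θ := rfl
@[simp] theorem dir_one_apply (θ : ℝ) : dir θ 1 = Real.sin θ := rfl
@[simp] theorem rot_zero_apply (v : Plane) : rot v 0 = -v 1 := rfl
@[simp] theorem rot_one_apply (v : Plane) : rot v 1 = v 0 := rfl

theorem plane_ext {v w : Plane} (h0 : v 0 = w 0) (h1 : v 1 = w 1) : v = w := by
  ext i; fin_cases i
  · exact h0
  · exact h1

theorem inner_plane (v w : Plane) : ⟪v, w⟫ = v 0 * w 0 + v 1 * w 1 := by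
  rw [PiLp.inner_apply, Fin.sum_univ_two]
  simp [mul_comm]

/-- Rotation by a right angle as a continuous linear map. -/
noncomputable def rotCLM : Plane →L[ℝ] Plane :=
  LinearMap.toContinuousLinearMap
    { toFun := rot
      map_add' := fun v w => plane_ext (by simp; ring) (by simp)
      map_smul' := fun c v => plane_ext (by simp) (by simp) }

@[simp] theorem rotCLM_apply (v : Plane) : rotCLM v = rot v := rfl

theorem rot_smul (c : ℝ) (v : Plane) : rot (c • v) = c • rot v := rotCLM.map_smul c v

theorem rot_rot (v : Plane) : rot (rot v) = -v := plane_ext (by simp) (by simp)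

theorem norm_rot (v : Plane) : ‖rot v‖ = ‖v‖ := by
  rw [← sq_eq_sq₀ (norm_nonneg _) (norm_nonneg _), ← real_inner_self_eq_norm_sq,
    ← real_inner_self_eq_norm_sq, inner_plane, inner_plane]
  simp; ring

theorem inner_rot_self (v : Plane) : ⟪rot v, v⟫ = 0 := by
  rw [inner_plane]; simp; ring

theorem inner_dir_dir (α β : ℝ) : ⟪dir α, dir β⟫ = Real.cos (β - α) := by
  rw [inner_plane, Real.cos_sub]; simp; ring

theorem inner_rot_dir_dir (α β : ℝ) : ⟪rot (dir α), dir β⟫ = Real.sin (β - α) := by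
  rw [inner_plane, Real.sin_sub]; simp; ring

theorem norm_dir (θ : ℝ) : ‖dir θ‖ = 1 := by
  have h : ‖dir θ‖ ^ 2 = 1 := by
    rw [← real_inner_self_eq_norm_sq, inner_dir_dir]; simp
  nlinarith [norm_nonneg (dir θ)]

theorem dir_periodic : Function.Periodic dir (2 * Real.pi) := fun θ =>
  plane_ext (by simp) (by simp)

theorem hasDerivAt_dir (θ : ℝ) : HasDerivAt dir (rot (dir θ)) θ := by
  have h1 : dir = fun θ => Real.cos θ • (!₂[1, 0] : Plane) + Real.sin θ • (!₂[0, 1] : Plane) :=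
    funext fun θ => plane_ext (by simp) (by simp)
  have h2 := ((Real.hasDerivAt_cos θ).smul_const (!₂[1, 0] : Plane)).add
    ((Real.hasDerivAt_sin θ).smul_const (!₂[0, 1] : Plane))
  rw [h1]
  convert! h2 using 1
  exact plane_ext (by simp) (by simp)

theorem contDiff_dir : ContDiff ℝ ∞ dir := by
  have h1 : dir = fun θ => Real.cos θ • (!₂[1, 0] : Plane) + Real.sin θ • (!₂[0, 1] : Plane) :=
    funext fun θ => plane_ext (by simp) (by simp)
  rw [h1]
  exact (Real.contDiff_cos.smul contDiff_const).add (Real.contDiff_sin.smul contDiff_const)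

theorem hasDerivAt_rot_dir (θ : ℝ) : HasDerivAt (fun θ => rot (dir θ)) (-dir θ) θ := by
  have := rotCLM.hasFDerivAt.comp_hasDerivAt θ (hasDerivAt_dir θ)
  rw [rotCLM_apply, rot_rot] at this
  exact this

/-- A vector in the frame of the direction `θ`. -/
theorem eq_inner_smul_dir_add (v : Plane) (θ : ℝ) :
    v = ⟪v, dir θ⟫ • dir θ + ⟪v, rot (dir θ)⟫ • rot (dir θ) := by
  have h := Real.sin_sq_add_cos_sq θ
  refine plane_ext ?_ ?_ <;> simp only [inner_plane] <;> simp
  · linear_combination (-v 0) * h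
  · linear_combination (-v 1) * h

theorem exists_dir {v : Plane} (hv : v ≠ 0) : ∃ θ, v = ‖v‖ • dir θ := by
  have hn : 0 < ‖v‖ := norm_pos_iff.2 hv
  have hsq : ‖v‖ ^ 2 = v 0 ^ 2 + v 1 ^ 2 := by
    rw [← real_inner_self_eq_norm_sq, inner_plane]; ring
  let z : ℂ := ⟨v 0, v 1⟩
  have hz : ‖z‖ = ‖v‖ := by
    rw [← sq_eq_sq₀ (norm_nonneg _) (norm_nonneg _), hsq, Complex.sq_norm, Complex.normSq_apply]
    simp only [z]; ring
  have hz0 : z ≠ 0 := by rw [← norm_pos_iff, hz]; exact hn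
  refine ⟨z.arg, plane_ext ?_ ?_⟩
  · simp [Complex.cos_arg hz0, hz, z]; field_simp
  · simp [Complex.sin_arg, hz, z]; field_simp

end Plane

/-! ### From a support function to its boundary points. -/

section Support

variable {u : ℝ → ℝ}

/-- The boundary point with outward normal `dir θ` of the convex region with support function
`u`. -/
noncomputable def point (u : ℝ → ℝ) (θ : ℝ) : Plane := u θ • dir θ + deriv u θ • rot (dir θ)

theorem contDiff_deriv (hu : ContDiff ℝ ∞ u) : ContDiff ℝ ∞ (deriv u) :=
  (contDiff_infty_iff_deriv.1 hu).2

theorem hasDerivAt_of_contDiff {E : Type*} [NormedAddCommGroup E] [NormedSpace ℝ E] {f : ℝ → E}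
    (hf : ContDiff ℝ ∞ f) (x : ℝ) : HasDerivAt f (deriv f x) x :=
  (hf.differentiable (by simp)).differentiableAt.hasDerivAt

theorem contDiff_radius (hu : ContDiff ℝ ∞ u) : ContDiff ℝ ∞ (radius u) :=
  (contDiff_deriv (contDiff_deriv hu)).add hu

theorem periodic_deriv {f : ℝ → ℝ} {c : ℝ} (hf : Function.Periodic f c) :
    Function.Periodic (deriv f) c := fun x => by
  rw [← deriv_comp_add_const]
  congr 1
  exact funext hf

theorem periodic_radius {c : ℝ} (hu : Function.Periodic u c) : Function.Periodic (radius u) c :=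
  fun x => by simp only [radius, hu x, periodic_deriv (periodic_deriv hu) x]

theorem periodic_point (hu : Function.Periodic u (2 * Real.pi)) :
    Function.Periodic (point u) (2 * Real.pi) := fun x => by
  simp only [point, hu x, periodic_deriv hu x, dir_periodic x]

theorem contDiff_point (hu : ContDiff ℝ ∞ u) : ContDiff ℝ ∞ (point u) :=
  (hu.smul contDiff_dir).add ((contDiff_deriv hu).smul (rotCLM.contDiff.comp contDiff_dir))

/-- The components along `dir θ` cancel, so `dir θ` is indeed normal and `radius u` is the radius of
curvature. -/
theorem hasDerivAt_point (hu : ContDiff ℝ ∞ u) (θ : ℝ) :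
    HasDerivAt (point u) (radius u θ • rot (dir θ)) θ := by
  have h1 := (hasDerivAt_of_contDiff hu θ).smul (hasDerivAt_dir θ)
  have h2 := (hasDerivAt_of_contDiff (contDiff_deriv hu) θ).smul (hasDerivAt_rot_dir θ)
  convert! h1.add h2 using 1
  simp only [radius]
  module

theorem inner_point_dir (u : ℝ → ℝ) (θ : ℝ) : ⟪point u θ, dir θ⟫ = u θ := by
  rw [point, inner_add_left, real_inner_smul_left, real_inner_smul_left, inner_dir_dir,
    inner_rot_dir_dir]
  simp

theorem hasDerivAt_inner_point (hu : ContDiff ℝ ∞ u) (α β : ℝ) :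
    HasDerivAt (fun β => ⟪point u β, dir α⟫) (radius u β * Real.sin (α - β)) β := by
  have := (hasDerivAt_point hu β).inner ℝ (hasDerivAt_const β (dir α))
  simpa [real_inner_smul_left, inner_rot_dir_dir] using this

/-- The height of `point u β` in the direction `α` has derivative `radius u β * sin (α - β)`: it
rises strictly on the half turn before `α` and falls strictly on the half turn after it. -/
theorem inner_point_lt_of_abs_le (hu : ContDiff ℝ ∞ u) (hρ : ∀ θ, 0 < radius u θ) {α β : ℝ}
    (h0 : β ≠ α) (hπ : |β - α| ≤ Real.pi) : ⟪point u β, dir α⟫ < u α := by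
  have hc : Continuous (fun β => ⟪point u β, dir α⟫) :=
    continuous_iff_continuousAt.2 fun β => (hasDerivAt_inner_point hu α β).continuousAt
  have hd : ∀ β, deriv (fun β => ⟪point u β, dir α⟫) β = radius u β * Real.sin (α - β) :=
    fun β => (hasDerivAt_inner_point hu α β).deriv
  rw [← inner_point_dir u α]
  rcases lt_or_gt_of_ne h0 with h | h
  · refine strictMonoOn_of_deriv_pos (convex_Icc (α - Real.pi) α) hc.continuousOn ?_ ?_ ?_ h
    · intro β hβ
      rw [interior_Icc] at hβ
      rw [hd]
      exact mul_pos (hρ β) (Real.sin_pos_of_pos_of_lt_pi (by linarith [hβ.2]) (by linarith [hβ.1]))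
    · exact ⟨by linarith [(abs_le.1 hπ).1], h.le⟩
    · exact ⟨by linarith [Real.pi_pos], le_rfl⟩
  · refine strictAntiOn_of_deriv_neg (convex_Icc α (α + Real.pi)) hc.continuousOn ?_ ?_ ?_ h
    · intro β hβ
      rw [interior_Icc] at hβ
      rw [hd]
      exact mul_neg_of_pos_of_neg (hρ β)
        (Real.sin_neg_of_neg_of_neg_pi_lt (by linarith [hβ.1]) (by linarith [hβ.2]))
    · exact ⟨le_rfl, by linarith [Real.pi_pos]⟩
    · exact ⟨h.le, by linarith [(abs_le.1 hπ).2]⟩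

theorem exists_int_abs_sub_le_pi (α β : ℝ) :
    ∃ k : ℤ, |(β - k * (2 * Real.pi)) - α| ≤ Real.pi := by
  have hπ := Real.pi_pos
  refine ⟨round ((β - α) / (2 * Real.pi)), ?_⟩
  have h := abs_sub_round ((β - α) / (2 * Real.pi))
  set k := round ((β - α) / (2 * Real.pi))
  have e : (β - k * (2 * Real.pi)) - α = ((β - α) / (2 * Real.pi) - k) * (2 * Real.pi) := by
    field_simp; ring
  rw [e, abs_mul, abs_of_pos (by positivity : 0 < 2 * Real.pi)]
  nlinarith

theorem inner_point_lt (hu : ContDiff ℝ ∞ u) (hp : Function.Periodic u (2 * Real.pi))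
    (hρ : ∀ θ, 0 < radius u θ) {α β : ℝ} (h : ∀ k : ℤ, β ≠ α + k * (2 * Real.pi)) :
    ⟪point u β, dir α⟫ < u α := by
  obtain ⟨k, hk⟩ := exists_int_abs_sub_le_pi α β
  have e : point u (β - k * (2 * Real.pi)) = point u β := (periodic_point hp).sub_int_mul_eq k
  rw [← e]
  exact inner_point_lt_of_abs_le hu hρ (fun h' => h k (by linarith)) hk

theorem inner_point_le (hu : ContDiff ℝ ∞ u) (hp : Function.Periodic u (2 * Real.pi))
    (hρ : ∀ θ, 0 < radius u θ) (α β : ℝ) : ⟪point u β, dir α⟫ ≤ u α := by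
  by_cases h : ∀ k : ℤ, β ≠ α + k * (2 * Real.pi)
  · exact (inner_point_lt hu hp hρ h).le
  · push Not at h
    obtain ⟨k, rfl⟩ := h
    rw [(periodic_point hp).int_mul k α, inner_point_dir]

end Support

/-! ### Geometry of the curve with given support function and normal angle. -/

section Curve

/-- A smooth change of parameter of the circle `ℝ / 2πℤ` of degree `ε = ± 1`. -/
structure IsAngle (ε : ℝ) (θ : ℝ → ℝ) : Prop where
  sign : ε = 1 ∨ ε = -1
  smooth : ContDiff ℝ ∞ θ
  deriv_pos : ∀ φ, 0 < ε * deriv θ φ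
  add_period : ∀ φ, θ (φ + 2 * Real.pi) = θ φ + ε * (2 * Real.pi)

namespace IsAngle

variable {ε : ℝ} {θ : ℝ → ℝ}

theorem mul_self (h : IsAngle ε θ) : ε * ε = 1 := by
  rcases h.sign with rfl | rfl <;> norm_num

theorem strictMono (h : IsAngle ε θ) : StrictMono (fun φ => ε * θ φ) :=
  strictMono_of_deriv_pos fun φ => by
    rw [((hasDerivAt_of_contDiff h.smooth φ).const_mul ε).deriv]
    exact h.deriv_pos φ

theorem injective (h : IsAngle ε θ) : Function.Injective θ := fun φ ψ e =>
  h.strictMono.injective (by simp [e])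

theorem add_int_mul (h : IsAngle ε θ) (φ : ℝ) (k : ℤ) :
    θ (φ + k * (2 * Real.pi)) = θ φ + k * (ε * (2 * Real.pi)) := by
  have hp : Function.Periodic (fun φ => θ φ - ε * φ) (2 * Real.pi) := fun φ => by
    simp only [h.add_period]; ring
  have := hp.int_mul k φ
  linear_combination this

/-- Adding periods makes `θ` unbounded in both directions; the intermediate value theorem does the
rest. -/
theorem surjective (h : IsAngle ε θ) : Function.Surjective θ := by
  intro y
  have hπ := Real.pi_pos
  refine mem_range_of_exists_le_of_exists_ge h.smooth.continuous ?_ ?_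
  · obtain ⟨k, hk⟩ := exists_int_gt ((θ 0 - y) / (2 * Real.pi))
    rw [div_lt_iff₀ (by positivity)] at hk
    rcases h.sign with rfl | rfl
    · exact ⟨0 + (-k : ℤ) * (2 * Real.pi), by rw [h.add_int_mul]; push_cast; linarith⟩
    · exact ⟨0 + k * (2 * Real.pi), by rw [h.add_int_mul]; linarith⟩
  · obtain ⟨k, hk⟩ := exists_int_gt ((y - θ 0) / (2 * Real.pi))
    rw [div_lt_iff₀ (by positivity)] at hk
    rcases h.sign with rfl | rfl
    · exact ⟨0 + k * (2 * Real.pi), by rw [h.add_int_mul]; linarith⟩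
    · exact ⟨0 + (-k : ℤ) * (2 * Real.pi), by rw [h.add_int_mul]; push_cast; linarith⟩

end IsAngle

variable {u : ℝ → ℝ} {ε : ℝ} {θ : ℝ → ℝ}

theorem hasDerivAt_curve (hu : ContDiff ℝ ∞ u) (hθ : IsAngle ε θ) (φ : ℝ) :
    HasDerivAt (fun φ => point u (θ φ)) ((deriv θ φ * radius u (θ φ)) • rot (dir (θ φ))) φ := by
  have := (hasDerivAt_point hu (θ φ)).scomp φ (hasDerivAt_of_contDiff hθ.smooth φ)
  simpa only [smul_smul] using! this

theorem norm_deriv_curve (hu : ContDiff ℝ ∞ u) (hρ : ∀ θ, 0 < radius u θ) (hθ : IsAngle ε θ)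
    (φ : ℝ) : ‖deriv (fun φ => point u (θ φ)) φ‖ = ε * deriv θ φ * radius u (θ φ) := by
  have h1 := mul_pos (hθ.deriv_pos φ) (hρ (θ φ))
  rw [(hasDerivAt_curve hu hθ φ).deriv, norm_smul, norm_rot, norm_dir, mul_one, Real.norm_eq_abs]
  rcases hθ.sign with rfl | rfl
  · rw [abs_of_pos (by linarith)]; ring
  · rw [abs_of_neg (by linarith)]; ring

theorem leftNormal_curve (hu : ContDiff ℝ ∞ u) (hρ : ∀ θ, 0 < radius u θ) (hθ : IsAngle ε θ)
    (φ : ℝ) : leftNormal (fun φ => point u (θ φ)) φ = -(ε • dir (θ φ)) := by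
  have h1 := mul_pos (hθ.deriv_pos φ) (hρ (θ φ))
  have h2 := h1.ne'
  rw [leftNormal, norm_deriv_curve hu hρ hθ, (hasDerivAt_curve hu hθ φ).deriv, rot_smul, rot_rot,
    smul_neg, smul_neg, smul_smul]
  congr 2
  rw [inv_mul_eq_iff_eq_mul₀ h2]
  linear_combination -(deriv θ φ * radius u (θ φ)) * hθ.mul_self

theorem inwardNormal_curve (hu : ContDiff ℝ ∞ u) (hp : Function.Periodic u (2 * Real.pi))
    (hρ : ∀ θ, 0 < radius u θ) (hθ : IsAngle ε θ) (φ : ℝ) :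
    inwardNormal (fun φ => point u (θ φ)) φ = -dir (θ φ) := by
  rw [inwardNormal, leftNormal_curve hu hρ hθ]
  rcases hθ.sign with rfl | rfl
  · rw [one_smul, if_pos]
    intro ψ
    rw [inner_neg_right, inner_sub_left, inner_point_dir]
    linarith [inner_point_le hu hp hρ (θ φ) (θ ψ)]
  · rw [if_neg]
    · simp
    -- For `ε = -1` the left normal points outward. The point with the opposite normal angle lies
    -- strictly inside the tangent line, which refutes the condition of the `if`.
    · intro h
      obtain ⟨ψ, hψ⟩ := hθ.surjective (θ φ + Real.pi)
      have h1 := h ψ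
      have hπ := Real.pi_pos
      have h2 := inner_point_lt_of_abs_le hu hρ (α := θ φ) (β := θ φ + Real.pi) (by linarith)
        (by rw [add_sub_cancel_left, abs_of_pos hπ])
      simp only [neg_smul, one_smul, neg_neg, inner_sub_left, inner_point_dir, hψ] at h1
      linarith

/-- Only the turning of the tangent contributes along the normal: the component of the second
derivative is `θ'² ρ`, to be divided by the squared speed `θ'² ρ²`. -/
theorem curvature_curve (hu : ContDiff ℝ ∞ u) (hp : Function.Periodic u (2 * Real.pi))
    (hρ : ∀ θ, 0 < radius u θ) (hθ : IsAngle ε θ) (φ : ℝ) :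
    curvature (fun φ => point u (θ φ)) φ = 1 / radius u (θ φ) := by
  have hd : deriv (fun φ => point u (θ φ))
      = fun φ => (deriv θ φ * radius u (θ φ)) • rot (dir (θ φ)) :=
    funext fun φ => (hasDerivAt_curve hu hθ φ).deriv
  have hg := hasDerivAt_of_contDiff
    ((contDiff_deriv hθ.smooth).mul ((contDiff_radius hu).comp hθ.smooth)) φ
  have hr := (hasDerivAt_rot_dir (θ φ)).scomp φ (hasDerivAt_of_contDiff hθ.smooth φ)
  have h2 := (hg.smul hr).deriv
  have hne : deriv θ φ ≠ 0 := fun h => by simpa [h] using hθ.deriv_pos φ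
  have hρ' := (hρ (θ φ)).ne'
  have hε := hθ.mul_self
  rw [curvature, inwardNormal_curve hu hp hρ hθ, norm_deriv_curve hu hρ hθ, hd]
  have h3 : deriv (fun φ => (deriv θ φ * radius u (θ φ)) • rot (dir (θ φ))) φ = _ := h2
  rw [h3]
  simp only [inner_add_left, inner_neg_right, real_inner_smul_left, inner_neg_left,
    Function.comp_apply, inner_dir_dir, inner_rot_dir_dir, sub_self, Real.sin_zero, Real.cos_zero]
  have h4 : (ε * deriv θ φ * radius u (θ φ)) ^ 2 = (deriv θ φ * radius u (θ φ)) ^ 2 := by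
    linear_combination (deriv θ φ * radius u (θ φ)) ^ 2 * hε
  rw [h4]
  field_simp
  simp

theorem isStrictlyConvexCurve_curve (hu : ContDiff ℝ ∞ u)
    (hp : Function.Periodic u (2 * Real.pi)) (hρ : ∀ θ, 0 < radius u θ) (hθ : IsAngle ε θ) :
    IsStrictlyConvexCurve (fun φ => point u (θ φ)) where
  smooth := (contDiff_point hu).comp hθ.smooth
  periodic φ := by
    simp only [hθ.add_period]
    rcases hθ.sign with rfl | rfl
    · rw [one_mul]; exact periodic_point hp _
    · rw [neg_one_mul]; exact (periodic_point hp).sub_eq (θ φ)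
  regular φ := by
    have h1 := mul_pos (hθ.deriv_pos φ) (hρ (θ φ))
    rw [← norm_pos_iff, norm_deriv_curve hu hρ hθ]
    exact h1
  simple := by
    have key : ∀ φ ψ : ℝ, φ ≤ ψ → ψ < φ + 2 * Real.pi →
        point u (θ φ) = point u (θ ψ) → φ = ψ := by
      intro φ ψ h1 h2 e
      have m1 : ε * θ φ ≤ ε * θ ψ := hθ.strictMono.monotone h1
      have m2 : ε * θ ψ < ε * θ (φ + 2 * Real.pi) := hθ.strictMono h2
      rw [hθ.add_period] at m2
      have hε := hθ.mul_self
      -- Different normals modulo `2π` give different points by strict support; equal ones are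
      -- excluded because `ε * θ` increases by less than `2π` from `φ` to `ψ`.
      by_cases h : ∀ k : ℤ, θ φ ≠ θ ψ + k * (2 * Real.pi)
      · have := inner_point_lt hu hp hρ h
        rw [e, inner_point_dir] at this
        exact absurd this (lt_irrefl _)
      · push Not at h
        obtain ⟨k, hk⟩ := h
        have hπ := Real.pi_pos
        have hk0 : k = 0 := by
          rw [hk] at m1 m2
          rcases hθ.sign with rfl | rfl
          · have a1 : (k : ℝ) < 1 := by nlinarith
            have a2 : (-1 : ℝ) < k := by nlinarith
            have a1' : k < 1 := by exact_mod_cast a1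
            have a2' : -1 < k := by exact_mod_cast a2
            omega
          · have a1 : (k : ℝ) < 1 := by nlinarith
            have a2 : (-1 : ℝ) < k := by nlinarith
            have a1' : k < 1 := by exact_mod_cast a1
            have a2' : -1 < k := by exact_mod_cast a2
            omega
        exact hθ.injective (by rw [hk, hk0]; simp)
    intro φ hφ ψ hψ e
    rcases le_total φ ψ with h | h
    · exact key φ ψ h (by linarith [hφ.1, hψ.2]) e
    · exact (key ψ φ h (by linarith [hψ.1, hφ.2]) e.symm).symm
  convex φ := by
    simp only [leftNormal_curve hu hρ hθ, inner_neg_right, real_inner_smul_right, inner_sub_left,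
      inner_point_dir]
    have h := fun ψ => inner_point_le hu hp hρ (θ φ) (θ ψ)
    rcases hθ.sign with rfl | rfl
    · exact Or.inl fun ψ => by linarith [h ψ]
    · exact Or.inr fun ψ => by linarith [h ψ]
  curvature_pos φ := by
    rw [curvature_curve hu hp hρ hθ]
    exact one_div_pos.2 (hρ _)

theorem supportFun_curve (hu : ContDiff ℝ ∞ u)
    (hp : Function.Periodic u (2 * Real.pi)) (hρ : ∀ θ, 0 < radius u θ) (hθ : IsAngle ε θ) :
    supportFun (fun φ => point u (θ φ)) = u := by
  funext α
  obtain ⟨φ, hφ⟩ := hθ.surjective α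
  refine IsLUB.ciSup_eq (IsGreatest.isLUB ⟨⟨φ, ?_⟩, ?_⟩)
  · simp only [hφ, inner_point_dir]
  · rintro _ ⟨ψ, rfl⟩
    exact inner_point_le hu hp hρ α (θ ψ)

theorem integral_deriv_periodic {E : Type*} [NormedAddCommGroup E] [NormedSpace ℝ E]
    [CompleteSpace E] {f f' : ℝ → E} {c : ℝ}
    (hf : ∀ x, HasDerivAt f (f' x) x) (hc : Continuous f') (hp : Function.Periodic f c) :
    ∫ x in (0 : ℝ)..c, f' x = 0 := by
  rw [intervalIntegral.integral_eq_sub_of_hasDerivAt (fun x _ => hf x)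
    (hc.intervalIntegrable _ _), ← zero_add c, hp 0, sub_self]

theorem integral_radius (hu : ContDiff ℝ ∞ u) (hp : Function.Periodic u (2 * Real.pi)) :
    ∫ α in (0 : ℝ)..2 * Real.pi, radius u α = ∫ α in (0 : ℝ)..2 * Real.pi, u α := by
  have hc := (contDiff_deriv (contDiff_deriv hu)).continuous
  simp only [radius]
  rw [intervalIntegral.integral_add (hc.intervalIntegrable _ _)
    (hu.continuous.intervalIntegrable _ _), integral_deriv_periodic
    (hasDerivAt_of_contDiff (contDiff_deriv hu)) hc (periodic_deriv hp), zero_add]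

/-- Cauchy's formula: the speed is `ε θ' ρ(θ)`, a change of variables leaves the integral of `radius
u` over a period, and `u''` integrates to zero. -/
theorem length_curve (hu : ContDiff ℝ ∞ u)
    (hp : Function.Periodic u (2 * Real.pi)) (hρ : ∀ θ, 0 < radius u θ) (hθ : IsAngle ε θ) :
    length (fun φ => point u (θ φ)) = ∫ α in (0 : ℝ)..2 * Real.pi, u α := by
  rw [length, ← integral_radius hu hp]
  have hrp : Function.Periodic (radius u) (2 * Real.pi) := periodic_radius hp
  have e : ∀ φ, ‖deriv (fun φ => point u (θ φ)) φ‖ = ε * ((radius u ∘ θ) φ * deriv θ φ) :=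
    fun φ => by rw [norm_deriv_curve hu hρ hθ, Function.comp_apply]; ring
  simp only [e]
  rw [intervalIntegral.integral_const_mul, intervalIntegral.integral_comp_mul_deriv
    (fun x _ => hasDerivAt_of_contDiff hθ.smooth x) (contDiff_deriv hθ.smooth).continuous.continuousOn
    (contDiff_radius hu).continuous]
  have h2 := hθ.add_period 0
  rw [zero_add] at h2
  rw [h2]
  rcases hθ.sign with rfl | rfl
  · rw [one_mul, one_mul, hrp.intervalIntegral_add_eq (θ 0) 0, zero_add]
  · have h3 := hrp.intervalIntegral_add_eq (θ 0 + -1 * (2 * Real.pi)) 0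
    rw [zero_add] at h3
    rw [← h3, intervalIntegral.integral_symm]
    simp

end Curve

/-! ### The enclosed region and its area. -/

section Area

variable {u : ℝ → ℝ}

/-- The convex region with support function `u`. -/
def region (u : ℝ → ℝ) : Set Plane := {x | ∀ α, ⟪x, dir α⟫ ≤ u α}

/-- The scale `s` is the gauge of the region, the maximum of `⟪x, dir α⟫ / u α`. At a maximum `θ`
the vanishing derivative says that `x` is proportional to `point u θ`. The maximum is positive
because the direction of `x` itself competes. -/
theorem exists_eq_smul_point (hu : ContDiff ℝ ∞ u) (hp : Function.Periodic u (2 * Real.pi))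
    (hpos : ∀ θ, 0 < u θ) {x : Plane} (hx : x ∈ region u) (hx0 : x ≠ 0) :
    ∃ s ∈ Ioc (0 : ℝ) 1, ∃ θ ∈ Ico (0 : ℝ) (2 * Real.pi), x = s • point u θ := by
  have hd : ∀ α, HasDerivAt (fun α => ⟪x, dir α⟫ / u α)
      ((⟪x, rot (dir α)⟫ * u α - ⟪x, dir α⟫ * deriv u α) / u α ^ 2) α := fun α => by
    have h1 := (hasDerivAt_const α x).inner ℝ (hasDerivAt_dir α)
    simp only [inner_zero_left, add_zero] at h1
    exact h1.div (hasDerivAt_of_contDiff hu α) (hpos α).ne'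
  have hfp : Function.Periodic (fun α => ⟪x, dir α⟫ / u α) (2 * Real.pi) := fun α => by
    simp only [dir_periodic α, hp α]
  have hfc : Continuous (fun α => ⟪x, dir α⟫ / u α) :=
    continuous_iff_continuousAt.2 fun α => (hd α).continuousAt
  obtain ⟨β, -, hβ⟩ := (isCompact_Icc (a := (0 : ℝ)) (b := 2 * Real.pi)).exists_isMaxOn
    ⟨0, by simp [Real.pi_pos.le]⟩ hfc.continuousOn
  have hmaxβ : ∀ α, ⟪x, dir α⟫ / u α ≤ ⟪x, dir β⟫ / u β := fun α => by
    obtain ⟨α', hα', e⟩ := hfp.exists_mem_Ico₀ Real.two_pi_pos α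
    exact e.trans_le (hβ (Ico_subset_Icc_self hα'))
  obtain ⟨θ, hθ, e⟩ := hfp.exists_mem_Ico₀ Real.two_pi_pos β
  have hmax : ∀ α, ⟪x, dir α⟫ / u α ≤ ⟪x, dir θ⟫ / u θ := fun α => (hmaxβ α).trans_eq e
  have hloc : IsLocalMax (fun α => ⟪x, dir α⟫ / u α) θ := Eventually.of_forall hmax
  have hz := hloc.hasDerivAt_eq_zero (hd θ)
  have huθ := hpos θ
  rw [div_eq_zero_iff, or_iff_left (by positivity), sub_eq_zero] at hz
  obtain ⟨η, hη⟩ := exists_dir hx0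
  refine ⟨⟪x, dir θ⟫ / u θ, ⟨lt_of_lt_of_le ?_ (hmax η), (div_le_one huθ).2 (hx θ)⟩, θ, hθ, ?_⟩
  · refine div_pos ?_ (hpos η)
    rw [hη, real_inner_smul_left, inner_dir_dir]
    simpa using norm_pos_iff.2 hx0
  · conv_lhs => rw [eq_inner_smul_dir_add x θ]
    rw [point, smul_add, smul_smul, smul_smul, div_mul_cancel₀ _ huθ.ne']
    congr 2
    field_simp
    exact hz

theorem deriv_sub_inner_dir (hu : ContDiff ℝ ∞ u) (c : Plane) :
    deriv (fun α => u α - ⟪c, dir α⟫) = fun α => deriv u α - ⟪c, rot (dir α)⟫ := by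
  funext α
  have h1 := (hasDerivAt_const α c).inner ℝ (hasDerivAt_dir α)
  simp only [inner_zero_left, add_zero] at h1
  exact ((hasDerivAt_of_contDiff hu α).sub h1).deriv

theorem radius_sub_inner_dir (hu : ContDiff ℝ ∞ u) (c : Plane) :
    radius (fun α => u α - ⟪c, dir α⟫) = radius u := by
  funext α
  have h1 := (hasDerivAt_const α c).inner ℝ (hasDerivAt_rot_dir α)
  simp only [inner_zero_left, add_zero] at h1
  have h2 := ((hasDerivAt_of_contDiff (contDiff_deriv hu) α).sub h1).deriv
  simp only [radius, deriv_sub_inner_dir hu]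
  have h3 : deriv (fun α => deriv u α - ⟪c, rot (dir α)⟫) α = _ := h2
  rw [h3, inner_neg_right]
  ring

/-- The midpoint of the boundary points with normal angles `0` and `π`. -/
noncomputable def center (u : ℝ → ℝ) : Plane := (1 / 2 : ℝ) • (point u 0 + point u Real.pi)

/-- A boundary point touches the support line only for its own normal angle. The angles `0` and `π`
differ modulo `2π`, so in every direction one of the two points is strictly below the line, and the
midpoint is interior. -/
theorem sub_inner_center_pos (hu : ContDiff ℝ ∞ u) (hp : Function.Periodic u (2 * Real.pi))
    (hρ : ∀ θ, 0 < radius u θ) (α : ℝ) : 0 < u α - ⟪center u, dir α⟫ := by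
  have e : u α - ⟪center u, dir α⟫ = (1 / 2) * (u α - ⟪point u 0, dir α⟫)
      + (1 / 2) * (u α - ⟪point u Real.pi, dir α⟫) := by
    simp only [center, real_inner_smul_left, inner_add_left]; ring
  have h1 := inner_point_le hu hp hρ α 0
  have h2 := inner_point_le hu hp hρ α Real.pi
  by_cases h : ∀ k : ℤ, (0 : ℝ) ≠ α + k * (2 * Real.pi)
  · have := inner_point_lt hu hp hρ h
    rw [e]; linarith
  · push Not at h
    obtain ⟨k, hk⟩ := h
    have h3 : ∀ m : ℤ, Real.pi ≠ α + m * (2 * Real.pi) := by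
      intro m hm
      have : (1 : ℝ) = 2 * (m - k) := by
        have : Real.pi * 1 = Real.pi * (2 * (m - k)) := by linear_combination hm - hk
        exact mul_left_cancel₀ Real.pi_pos.ne' this
      have h4 : (1 : ℤ) = 2 * (m - k) := by exact_mod_cast this
      omega
    have := inner_point_lt hu hp hρ h3
    rw [e]; linarith

theorem point_sub_inner_dir (hu : ContDiff ℝ ∞ u) (c : Plane) (θ : ℝ) :
    point (fun α => u α - ⟪c, dir α⟫) θ = point u θ - c := by
  conv_rhs => rw [eq_inner_smul_dir_add c θ]
  rw [point, deriv_sub_inner_dir hu, point]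
  module

/-- With the origin moved to `center u` the support function is positive, so every point of the
region lies on a segment from the center to a boundary point. -/
theorem convexHull_range_point (hu : ContDiff ℝ ∞ u) (hp : Function.Periodic u (2 * Real.pi))
    (hρ : ∀ θ, 0 < radius u θ) : convexHull ℝ (range (point u)) = region u := by
  refine Subset.antisymm (convexHull_min ?_ ?_) fun x hx => ?_
  · rintro _ ⟨β, rfl⟩ α
    exact inner_point_le hu hp hρ α β
  · have : region u = ⋂ α, {x : Plane | ⟪x, dir α⟫ ≤ u α} := by
      ext; simp [region]
    rw [this]
    refine convex_iInter fun α => convex_halfSpace_le (f := fun x : Plane => ⟪x, dir α⟫)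
      ⟨fun x y => inner_add_left x y _, fun c x => real_inner_smul_left x _ c⟩ _
  · have hconv := convex_convexHull ℝ (range (point u))
    have hmem : ∀ θ, point u θ ∈ convexHull ℝ (range (point u)) := fun θ =>
      subset_convexHull ℝ _ (mem_range_self θ)
    have hc : center u ∈ convexHull ℝ (range (point u)) := by
      have := hconv (hmem 0) (hmem Real.pi) (a := 1 / 2) (b := 1 / 2)
        (by norm_num) (by norm_num) (by norm_num)
      rwa [center, smul_add]
    rcases eq_or_ne x (center u) with rfl | hxc
    · exact hc
    have hw : ContDiff ℝ ∞ (fun α => u α - ⟪center u, dir α⟫) :=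
      hu.sub (contDiff_const.inner ℝ contDiff_dir)
    have hwp : Function.Periodic (fun α => u α - ⟪center u, dir α⟫) (2 * Real.pi) := fun α => by
      simp only [hp α, dir_periodic α]
    obtain ⟨s, hs, θ, -, e⟩ := exists_eq_smul_point hw hwp (sub_inner_center_pos hu hp hρ)
      (x := x - center u) (fun α => by rw [inner_sub_left]; linarith [hx α]) (sub_ne_zero.2 hxc)
    rw [point_sub_inner_dir hu] at e
    have e' : x = s • point u θ + (1 - s) • center u := by
      rw [← sub_add_cancel x (center u), e]; module
    rw [e']
    exact hconv (hmem θ) hc hs.1.le (by linarith [hs.2]) (by ring)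

theorem smul_point_mem_region (hu : ContDiff ℝ ∞ u) (hp : Function.Periodic u (2 * Real.pi))
    (hρ : ∀ θ, 0 < radius u θ) (hpos : ∀ θ, 0 < u θ) {s : ℝ} (hs : s ∈ Ioc (0 : ℝ) 1) (θ : ℝ) :
    s • point u θ ∈ region u := fun α => by
  rw [real_inner_smul_left]
  have h1 := mul_le_mul_of_nonneg_left (inner_point_le hu hp hρ α θ) hs.1.le
  nlinarith [hpos α, hs.2]

theorem smul_point_injOn (hu : ContDiff ℝ ∞ u) (hp : Function.Periodic u (2 * Real.pi))
    (hρ : ∀ θ, 0 < radius u θ) (hpos : ∀ θ, 0 < u θ) {s s' θ θ' : ℝ} (hs : 0 < s) (hs' : 0 < s')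
    (hθ : θ ∈ Ico (0 : ℝ) (2 * Real.pi)) (hθ' : θ' ∈ Ico (0 : ℝ) (2 * Real.pi))
    (e : s • point u θ = s' • point u θ') : s = s' ∧ θ = θ' := by
  -- Pairing with `dir θ` gives `s * u θ ≤ s' * u θ`, because `u θ` is the greatest height in that
  -- direction.
  have key : ∀ {s s' θ θ' : ℝ}, 0 < s' → s • point u θ = s' • point u θ' → s ≤ s' := by
    intro s s' θ θ' hs' e
    have h1 : ⟪s • point u θ, dir θ⟫ = ⟪s' • point u θ', dir θ⟫ := by rw [e]
    rw [real_inner_smul_left, real_inner_smul_left, inner_point_dir] at h1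
    have h2 := mul_le_mul_of_nonneg_left (inner_point_le hu hp hρ θ θ') hs'.le
    rw [← h1] at h2
    exact le_of_mul_le_mul_right h2 (hpos θ)
  have hss : s = s' := le_antisymm (key hs' e) (key hs e.symm)
  refine ⟨hss, ?_⟩
  rw [← hss] at e
  have e' : point u θ = point u θ' := smul_right_injective _ hs.ne' e
  by_cases h : ∀ k : ℤ, θ ≠ θ' + k * (2 * Real.pi)
  · have := inner_point_lt hu hp hρ h
    rw [e', inner_point_dir] at this
    exact absurd this (lt_irrefl _)
  · push Not at h
    obtain ⟨k, hk⟩ := h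
    have hπ := Real.pi_pos
    have a1 : (k : ℝ) < 1 := by nlinarith [hθ.2, hθ'.1]
    have a2 : (-1 : ℝ) < k := by nlinarith [hθ.1, hθ'.2]
    have a1' : k < 1 := by exact_mod_cast a1
    have a2' : -1 < k := by exact_mod_cast a2
    have hk0 : k = 0 := by omega
    simpa [hk0] using hk

/-- The plane with its two coordinates. -/
noncomputable def planeEquiv : Plane ≃ᵐ ℝ × ℝ :=
  (MeasurableEquiv.toLp 2 (Fin 2 → ℝ)).symm.trans MeasurableEquiv.finTwoArrow

theorem measurePreserving_planeEquiv : MeasurePreserving planeEquiv volume volume :=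
  (PiLp.volume_preserving_ofLp (Fin 2)).trans (volume_preserving_finTwoArrow ℝ)

/-- Generalized polar coordinates `(s, θ) ↦ s • point u θ` have Jacobian `s * u * ρ`, and `∫ s ds =
1/2`. The half-open parameter rectangle makes them injective; they miss only the origin. -/
theorem volume_region_of_pos (hu : ContDiff ℝ ∞ u) (hp : Function.Periodic u (2 * Real.pi))
    (hρ : ∀ θ, 0 < radius u θ) (hpos : ∀ θ, 0 < u θ) :
    (volume (region u)).toReal
      = (1 / 2) * ∫ α in (0 : ℝ)..2 * Real.pi, u α * radius u α := by
  let Ψ : ℝ × ℝ → ℝ × ℝ := fun p => (p.1 * point u p.2 0, p.1 * point u p.2 1)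
  let S : Set (ℝ × ℝ) := Ioc 0 1 ×ˢ Ico 0 (2 * Real.pi)
  have hSm : MeasurableSet S := measurableSet_Ioc.prod measurableSet_Ico
  have hΨ : ∀ p, Ψ p = planeEquiv (p.1 • point u p.2) := fun p => rfl
  have himg : Ψ '' S = planeEquiv '' (region u \ {0}) := by
    ext q
    constructor
    · rintro ⟨⟨s, θ⟩, ⟨hs, hθ⟩, rfl⟩
      refine ⟨s • point u θ, ⟨smul_point_mem_region hu hp hρ hpos hs θ, ?_⟩, rfl⟩
      intro h0
      have h1 : ⟪s • point u θ, dir θ⟫ = 0 := by rw [mem_singleton_iff.1 h0, inner_zero_left]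
      rw [real_inner_smul_left, inner_point_dir] at h1
      exact (mul_pos hs.1 (hpos θ)).ne' h1
    · rintro ⟨x, ⟨hx, hx0⟩, rfl⟩
      obtain ⟨s, hs, θ, hθ, e⟩ := exists_eq_smul_point hu hp hpos hx hx0
      exact ⟨(s, θ), ⟨hs, hθ⟩, by rw [hΨ, e]⟩
  have hinj : InjOn Ψ S := by
    rintro ⟨s, θ⟩ ⟨hs, hθ⟩ ⟨s', θ'⟩ ⟨hs', hθ'⟩ e
    rw [hΨ, hΨ] at e
    obtain ⟨h1, h2⟩ := smul_point_injOn hu hp hρ hpos hs.1 hs'.1 hθ hθ' (planeEquiv.injective e)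
    exact Prod.ext h1 h2
  let Ψ' : ℝ × ℝ → ℝ × ℝ →L[ℝ] ℝ × ℝ := fun p =>
    (Matrix.toLin (.finTwoProd ℝ) (.finTwoProd ℝ)
      !![point u p.2 0, p.1 * (radius u p.2 * -Real.sin p.2);
        point u p.2 1, p.1 * (radius u p.2 * Real.cos p.2)]).toContinuousLinearMap
  have hcoord : ∀ (i : Fin 2) θ, HasDerivAt (fun θ => point u θ i)
      ((radius u θ • rot (dir θ)) i) θ := fun i θ =>
    (EuclideanSpace.proj (𝕜 := ℝ) i).hasFDerivAt.comp_hasDerivAt θ (hasDerivAt_point hu θ)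
  have hderiv : ∀ p ∈ S, HasFDerivWithinAt Ψ (Ψ' p) S p := by
    intro p _
    refine HasFDerivAt.hasFDerivWithinAt ?_
    simp only [Ψ']
    rw [Matrix.toLin_finTwoProd_toContinuousLinearMap]
    convert!
      HasFDerivAt.prodMk (𝕜 := ℝ)
        (hasFDerivAt_fst.mul ((hcoord 0 p.2).comp_hasFDerivAt p hasFDerivAt_snd))
        (hasFDerivAt_fst.mul ((hcoord 1 p.2).comp_hasFDerivAt p hasFDerivAt_snd)) using 2 <;>
    simp [smul_smul, add_comm]
    exact neg_smul (p.1 * (radius u p.2 * Real.sin p.2)) (ContinuousLinearMap.snd ℝ ℝ ℝ)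
  have hdet : ∀ p, (Ψ' p).det = p.1 * (u p.2 * radius u p.2) := by
    intro p
    have h := Real.sin_sq_add_cos_sq p.2
    simp only [Ψ', LinearMap.det_toContinuousLinearMap, LinearMap.det_toLin,
      Matrix.det_fin_two_of]
    simp only [point, PiLp.add_apply, PiLp.smul_apply, smul_eq_mul, dir_zero_apply, dir_one_apply,
      rot_zero_apply, rot_one_apply]
    linear_combination (p.1 * u p.2 * radius u p.2) * h
  have hcont : Continuous fun p : ℝ × ℝ => p.1 * (u p.2 * radius u p.2) := by
    have := hu.continuous
    have := (contDiff_radius hu).continuous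
    fun_prop
  have hvol : volume (region u) = ∫⁻ p in S, ENNReal.ofReal (p.1 * (u p.2 * radius u p.2)) := by
    rw [← measure_sdiff_null (measure_singleton (0 : Plane)) (s := region u),
      ← measurePreserving_planeEquiv.symm.measure_preimage_equiv (region u \ {0}),
      ← MeasurableEquiv.image_eq_preimage_symm, ← himg,
      ← lintegral_abs_det_fderiv_eq_addHaar_image volume hSm hderiv hinj]
    refine setLIntegral_congr_fun hSm fun p hp => ?_
    rw [hdet, abs_of_nonneg]
    exact mul_nonneg hp.1.1.le (mul_pos (hpos _) (hρ _)).le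
  rw [hvol, ← integral_eq_lintegral_of_nonneg_ae ?_ hcont.aestronglyMeasurable]
  · change ∫ p in Ioc (0 : ℝ) 1 ×ˢ Ico 0 (2 * Real.pi), p.1 * (u p.2 * radius u p.2)
      ∂((volume : Measure ℝ).prod volume) = _
    rw [setIntegral_prod_mul (fun s : ℝ => s) (fun α => u α * radius u α), integral_Ico_eq_integral_Ioc,
      ← intervalIntegral.integral_of_le zero_le_one,
      ← intervalIntegral.integral_of_le Real.two_pi_pos.le, integral_id]
    norm_num
  · refine (ae_restrict_iff' hSm).2 (Eventually.of_forall fun p hp => ?_)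
    exact mul_nonneg hp.1.1.le (mul_pos (hpos _) (hρ _)).le

/-- Translating `center u` to the origin reduces to positive `u`. The radius is unchanged, and the
extra term `⟪c, dir α⟫ * radius u α` integrates to zero, as the derivative of the periodic function
`⟪point u α, rot c⟫`. -/
theorem volume_region (hu : ContDiff ℝ ∞ u) (hp : Function.Periodic u (2 * Real.pi))
    (hρ : ∀ θ, 0 < radius u θ) :
    (volume (region u)).toReal
      = (1 / 2) * ∫ α in (0 : ℝ)..2 * Real.pi, u α * radius u α := by
  let c : Plane := center u
  let w : ℝ → ℝ := fun α => u α - ⟪c, dir α⟫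
  have hcd : ContDiff ℝ ∞ (fun α => ⟪c, dir α⟫) := contDiff_const.inner ℝ contDiff_dir
  have hw : ContDiff ℝ ∞ w := hu.sub hcd
  have hwp : Function.Periodic w (2 * Real.pi) := fun α => by
    simp only [w, hp α, dir_periodic α]
  have hwr : radius w = radius u := radius_sub_inner_dir hu c
  have hwpos : ∀ α, 0 < w α := sub_inner_center_pos hu hp hρ
  have hreg : region u = (fun x => x + -c) ⁻¹' region w := by
    ext x
    simp only [region, w, mem_preimage, mem_ofPred_eq]
    refine forall_congr' fun α => ?_
    rw [← sub_eq_add_neg, inner_sub_left]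
    constructor <;> intro h <;> linarith
  have hzero : ∫ α in (0 : ℝ)..2 * Real.pi, ⟪c, dir α⟫ * radius u α = 0 := by
    refine integral_deriv_periodic (f := fun α => ⟪point u α, rot c⟫) (fun α => ?_)
      (hcd.continuous.mul (contDiff_radius hu).continuous) fun α => by
        simp only [periodic_point hp α]
    have h1 := (hasDerivAt_point hu α).inner ℝ (hasDerivAt_const α (rot c))
    convert! h1 using 1
    rw [inner_zero_right, zero_add, real_inner_smul_left, inner_plane, inner_plane]
    simp only [dir_zero_apply, dir_one_apply, rot_zero_apply, rot_one_apply]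
    ring
  have hint : ∫ α in (0 : ℝ)..2 * Real.pi, u α * radius u α
      = ∫ α in (0 : ℝ)..2 * Real.pi, w α * radius w α := by
    have e : ∀ α, w α * radius w α = u α * radius u α - ⟪c, dir α⟫ * radius u α := fun α => by
      rw [hwr]; simp only [w]; ring
    simp only [e]
    rw [intervalIntegral.integral_sub, hzero, sub_zero]
    · exact (hu.continuous.mul (contDiff_radius hu).continuous).intervalIntegrable _ _
    · exact (hcd.continuous.mul (contDiff_radius hu).continuous).intervalIntegrable _ _
  rw [hreg, measure_preimage_add_right, hint]
  exact volume_region_of_pos hw hwp (by rw [hwr]; exact hρ) hwpos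

theorem area_curve {ε : ℝ} {θ : ℝ → ℝ} (hu : ContDiff ℝ ∞ u)
    (hp : Function.Periodic u (2 * Real.pi)) (hρ : ∀ θ, 0 < radius u θ) (hθ : IsAngle ε θ) :
    area (fun φ => point u (θ φ)) = (1 / 2) * ∫ α in (0 : ℝ)..2 * Real.pi, u α * radius u α := by
  have hr : range (fun φ => point u (θ φ)) = range (point u) :=
    hθ.surjective.range_comp (point u)
  rw [area, hr, convexHull_range_point hu hp hρ, volume_region hu hp hρ]

end Area

/-! ### Normal angle and support function of a given strictly convex curve. -/

section InitialCurve

variable {γ : ℝ → Plane}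

theorem contDiff_deriv_curve (hγ : ContDiff ℝ ∞ γ) : ContDiff ℝ ∞ (deriv γ) :=
  (contDiff_infty_iff_deriv.1 hγ).2

theorem contDiff_leftNormal (hγ : ContDiff ℝ ∞ γ) (hreg : ∀ φ, deriv γ φ ≠ 0) :
    ContDiff ℝ ∞ (leftNormal γ) := by
  have h := contDiff_deriv_curve hγ
  exact ((h.norm ℝ hreg).inv fun φ => norm_ne_zero_iff.2 (hreg φ)).smul (rotCLM.contDiff.comp h)

/-- The inward side of a strictly convex curve lies always on the left or always on the right. -/
theorem IsStrictlyConvexCurve.exists_sign (h : IsStrictlyConvexCurve γ) :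
    ∃ ε : ℝ, (ε = 1 ∨ ε = -1) ∧ (∀ φ ψ, 0 ≤ ε * ⟪γ ψ - γ φ, leftNormal γ φ⟫) ∧
      ∀ φ, 0 < ε * ⟪deriv (deriv γ) φ, leftNormal γ φ⟫ := by
  have hnum : ∀ φ, 0 < ⟪deriv (deriv γ) φ, inwardNormal γ φ⟫ := fun φ => by
    have h1 := h.curvature_pos φ
    have h2 : 0 < ‖deriv γ φ‖ ^ 2 := pow_pos (norm_pos_iff.2 (h.regular φ)) 2
    exact (div_pos_iff_of_pos_right h2).1 h1
  have hpos : ∀ φ, (∀ ψ, 0 ≤ ⟪γ ψ - γ φ, leftNormal γ φ⟫) →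
      0 < ⟪deriv (deriv γ) φ, leftNormal γ φ⟫ := fun φ hφ => by
    have := hnum φ
    rwa [inwardNormal, if_pos hφ] at this
  have hneg : ∀ φ, ¬ (∀ ψ, 0 ≤ ⟪γ ψ - γ φ, leftNormal γ φ⟫) →
      ⟪deriv (deriv γ) φ, leftNormal γ φ⟫ < 0 := fun φ hφ => by
    have := hnum φ
    rw [inwardNormal, if_neg hφ, inner_neg_right] at this
    linarith
  have hcont : Continuous fun φ => ⟪deriv (deriv γ) φ, leftNormal γ φ⟫ :=
    (contDiff_deriv_curve (contDiff_deriv_curve h.smooth)).continuous.inner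
      (contDiff_leftNormal h.smooth h.regular).continuous
  -- The signed curvature is continuous and never zero, so it has one sign; that sign decides the
  -- branch of `inwardNormal` everywhere at once.
  have hne : ∀ φ, ⟪deriv (deriv γ) φ, leftNormal γ φ⟫ ≠ 0 := fun φ => by
    by_cases hφ : ∀ ψ, 0 ≤ ⟪γ ψ - γ φ, leftNormal γ φ⟫
    · exact (hpos φ hφ).ne'
    · exact (hneg φ hφ).ne
  have hcase : (∀ φ, 0 < ⟪deriv (deriv γ) φ, leftNormal γ φ⟫) ∨
      ∀ φ, ⟪deriv (deriv γ) φ, leftNormal γ φ⟫ < 0 := by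
    by_contra! hcon
    obtain ⟨⟨a, ha⟩, b, hb⟩ := hcon
    obtain ⟨φ, hφ⟩ := mem_range_of_exists_le_of_exists_ge hcont ⟨a, ha⟩ ⟨b, hb⟩
    exact hne φ hφ
  rcases hcase with hc | hc
  · refine ⟨1, Or.inl rfl, fun φ => ?_, fun φ => by simpa using hc φ⟩
    have : ∀ ψ, 0 ≤ ⟪γ ψ - γ φ, leftNormal γ φ⟫ := by
      by_contra hφ
      exact lt_asymm (hneg φ hφ) (hc φ)
    simpa using this
  · refine ⟨-1, Or.inr rfl, fun φ => ?_, fun φ => by simpa using hc φ⟩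
    have hφ : ¬ ∀ ψ, 0 ≤ ⟪γ ψ - γ φ, leftNormal γ φ⟫ := fun hφ => lt_asymm (hpos φ hφ) (hc φ)
    simpa using (h.convex φ).resolve_left hφ

theorem IsStrictlyConvexCurve.not_eq (h : IsStrictlyConvexCurve γ) {φ ψ : ℝ} (h1 : φ < ψ)
    (h2 : ψ < φ + 2 * Real.pi) : γ φ ≠ γ ψ := by
  intro e
  have hπ := Real.two_pi_pos
  have key : ∀ x : ℝ, ∃ k : ℤ, x - k * (2 * Real.pi) ∈ Ico 0 (2 * Real.pi) := fun x => by
    refine ⟨toIcoDiv hπ 0 x, ?_⟩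
    have := sub_toIcoDiv_zsmul_mem_Ico hπ 0 x
    simpa using this
  obtain ⟨k, hk⟩ := key φ
  obtain ⟨l, hl⟩ := key ψ
  have e' : γ (φ - k * (2 * Real.pi)) = γ (ψ - l * (2 * Real.pi)) := by
    rw [h.periodic.sub_int_mul_eq, h.periodic.sub_int_mul_eq, e]
  have e2 := h.simple hk hl e'
  have e3 : ψ - φ = ((l - k : ℤ) : ℝ) * (2 * Real.pi) := by push_cast; linarith
  have a1 : (0 : ℝ) < ((l - k : ℤ) : ℝ) := by
    by_contra hcon
    nlinarith
  have a2 : ((l - k : ℤ) : ℝ) < 1 := by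
    by_contra hcon
    nlinarith
  have a1' : 0 < l - k := by exact_mod_cast a1
  have a2' : l - k < 1 := by exact_mod_cast a2
  omega

theorem dir_eq_dir {α β : ℝ} (h : dir α = dir β) : ∃ k : ℤ, α = β + k * (2 * Real.pi) := by
  have h1 : Real.cos (α - β) = 1 := by
    rw [← inner_dir_dir, h, inner_dir_dir]; simp
  obtain ⟨k, hk⟩ := (Real.cos_eq_one_iff _).1 h1
  exact ⟨k, by linarith⟩

/-- A smooth field of unit vectors along the line has a smooth angle. -/
theorem exists_angle_lift {n : ℝ → Plane} (hn : ContDiff ℝ ∞ n) (h1 : ∀ φ, ‖n φ‖ = 1) :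
    ∃ θ : ℝ → ℝ, ContDiff ℝ ∞ θ ∧ ∀ φ, n φ = dir (θ φ) := by
  have hn' : ContDiff ℝ ∞ (deriv n) := contDiff_deriv_curve hn
  let w : ℝ → ℝ := fun φ => ⟪deriv n φ, rot (n φ)⟫
  have hw : ContDiff ℝ ∞ w := hn'.inner ℝ (rotCLM.contDiff.comp hn)
  have hdir : ∀ φ, ∃ α, n φ = dir α := fun φ => by
    have hne : n φ ≠ 0 := by rw [← norm_pos_iff, h1]; exact one_pos
    obtain ⟨α, hα⟩ := exists_dir hne
    exact ⟨α, by rw [hα, h1, one_smul]⟩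
  have horth : ∀ φ, ⟪deriv n φ, n φ⟫ = 0 := fun φ => by
    have h2 := (hasDerivAt_of_contDiff hn φ).inner ℝ (hasDerivAt_of_contDiff hn φ)
    have h3 : (fun t => ⟪n t, n t⟫) = fun _ => (1 : ℝ) :=
      funext fun t => by rw [real_inner_self_eq_norm_sq, h1]; norm_num
    rw [h3] at h2
    have h4 := h2.unique (hasDerivAt_const φ (1 : ℝ))
    rw [real_inner_comm] at h4
    linarith
  have hderiv : ∀ φ, deriv n φ = w φ • rot (n φ) := fun φ => by
    obtain ⟨α, hα⟩ := hdir φ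
    have h2 := eq_inner_smul_dir_add (deriv n φ) α
    rw [← hα, horth, zero_smul, zero_add] at h2
    exact h2
  obtain ⟨α, hα⟩ := hdir 0
  -- The angle is the integral of the angular velocity `w`. Then `⟪n, dir θ⟫` is constant, equal to
  -- one, which forces the two unit vectors to coincide.
  let θ : ℝ → ℝ := fun φ => α + ∫ s in (0 : ℝ)..φ, w s
  have hθ : ∀ φ, HasDerivAt θ (w φ) φ := fun φ =>
    (intervalIntegral.integral_hasDerivAt_right (hw.continuous.intervalIntegrable _ _)
      (hw.continuous.stronglyMeasurableAtFilter _ _) hw.continuous.continuousAt).const_add α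
  have hg : ∀ φ, HasDerivAt (fun φ => ⟪n φ, dir (θ φ)⟫) 0 φ := fun φ => by
    have h2 := (hasDerivAt_of_contDiff hn φ).inner ℝ ((hasDerivAt_dir (θ φ)).scomp φ (hθ φ))
    convert! h2 using 1
    rw [hderiv, real_inner_smul_left, real_inner_smul_right, inner_plane, inner_plane]
    simp; ring
  refine ⟨θ, contDiff_infty_iff_deriv.2 ⟨fun φ => (hθ φ).differentiableAt, ?_⟩, fun φ => ?_⟩
  · rwa [funext fun φ => (hθ φ).deriv]
  · have h2 := is_const_of_deriv_eq_zero (fun φ => (hg φ).differentiableAt)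
      (fun φ => (hg φ).deriv) φ 0
    simp only [θ, intervalIntegral.integral_same, add_zero, hα, inner_dir_dir, sub_self,
      Real.cos_zero] at h2
    exact (inner_eq_one_iff_of_norm_eq_one (h1 φ) (norm_dir _)).1 h2

theorem rot_leftNormal (γ : ℝ → Plane) (φ : ℝ) :
    ‖deriv γ φ‖ • rot (leftNormal γ φ) = -deriv γ φ := by
  rw [leftNormal, rot_smul, rot_rot, smul_smul]
  rcases eq_or_ne (deriv γ φ) 0 with h | h
  · simp [h]
  · rw [mul_inv_cancel₀ (norm_ne_zero_iff.2 h), one_smul]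

theorem norm_leftNormal {φ : ℝ} (h : deriv γ φ ≠ 0) : ‖leftNormal γ φ‖ = 1 := by
  rw [leftNormal, norm_smul, norm_rot, norm_inv, norm_norm,
    inv_mul_cancel₀ (norm_ne_zero_iff.2 h)]

/-- A strictly convex curve is parametrized by the angle of its outward normal. -/
theorem IsStrictlyConvexCurve.exists_isAngle (h : IsStrictlyConvexCurve γ) :
    ∃ ε θ, IsAngle ε θ ∧ (∀ φ ψ, ⟪γ ψ - γ φ, dir (θ φ)⟫ ≤ 0) ∧
      ∀ φ, deriv γ φ = (ε * ‖deriv γ φ‖) • rot (dir (θ φ)) := by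
  obtain ⟨ε, hε, hside, hcurv⟩ := h.exists_sign
  have hε2 : ε * ε = 1 := by rcases hε with rfl | rfl <;> norm_num
  have hsm := contDiff_leftNormal h.smooth h.regular
  obtain ⟨θ, hθ, hn⟩ := exists_angle_lift (n := fun φ => (-ε) • leftNormal γ φ)
    (hsm.const_smul (-ε)) (fun φ => by
      rw [norm_smul, norm_leftNormal (h.regular φ)]
      rcases hε with rfl | rfl <;> simp)
  have hc : ∀ φ ψ, ⟪γ ψ - γ φ, dir (θ φ)⟫ ≤ 0 := fun φ ψ => by
    rw [← hn, real_inner_smul_right]; linarith [hside φ ψ]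
  have hd : ∀ φ, deriv γ φ = (ε * ‖deriv γ φ‖) • rot (dir (θ φ)) := fun φ => by
    rw [← hn, rot_smul, smul_smul, mul_right_comm, mul_neg, hε2, neg_one_mul, neg_smul,
      rot_leftNormal, neg_neg]
  have hdn : ∀ φ, HasDerivAt (fun φ => dir (θ φ)) (deriv θ φ • rot (dir (θ φ))) φ := fun φ =>
    (hasDerivAt_dir (θ φ)).scomp φ (hasDerivAt_of_contDiff hθ φ)
  have horth : ∀ φ, ⟪deriv γ φ, dir (θ φ)⟫ = 0 := fun φ => by
    rw [hd, real_inner_smul_left, inner_rot_self, mul_zero]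
  -- Differentiating `⟪γ', dir θ⟫ = 0` gives `ε θ' ‖γ'‖ = -⟪γ'', dir θ⟫`, which is positive by the
  -- curvature assumption.
  have hpos : ∀ φ, 0 < ε * deriv θ φ := fun φ => by
    have h2 := (hasDerivAt_of_contDiff (contDiff_deriv_curve h.smooth) φ).inner ℝ (hdn φ)
    rw [funext horth] at h2
    have h3 := h2.unique (hasDerivAt_const φ (0 : ℝ))
    rw [real_inner_smul_right, hd φ, real_inner_smul_left, real_inner_self_eq_norm_sq, norm_rot,
      norm_dir, ← hn φ, real_inner_smul_right] at h3
    have h4 := hcurv φ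
    have h5 := norm_pos_iff.2 (h.regular φ)
    have h6 : 0 < (ε * deriv θ φ) * ‖deriv γ φ‖ := by nlinarith
    exact (mul_pos_iff_of_pos_right h5).1 h6
  have hmono : StrictMono fun φ => ε * θ φ := strictMono_of_deriv_pos fun φ => by
    rw [((hasDerivAt_of_contDiff hθ φ).const_mul ε).deriv]; exact hpos φ
  -- Points with equal normals lie on a common tangent line. Then `s ↦ ⟪γ ψ - γ s, dir (θ s)⟫ ≤ 0`
  -- attains its maximum zero at `φ`, and its vanishing derivative kills the tangential component of
  -- `γ ψ - γ φ`.
  have hsame : ∀ φ ψ, dir (θ φ) = dir (θ ψ) → γ φ = γ ψ := by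
    intro φ ψ e
    have z1 : ⟪γ ψ - γ φ, dir (θ φ)⟫ = 0 := by
      refine le_antisymm (hc φ ψ) ?_
      have := hc ψ φ
      rw [← e, ← neg_sub, inner_neg_left] at this
      linarith
    have h2 := ((hasDerivAt_of_contDiff h.smooth φ).const_sub (γ ψ)).inner ℝ (hdn φ)
    have hmax : IsLocalMax (fun s => ⟪γ ψ - γ s, dir (θ s)⟫) φ :=
      Eventually.of_forall fun s => (hc s ψ).trans_eq z1.symm
    have h3 := hmax.hasDerivAt_eq_zero h2
    rw [inner_neg_left, horth, real_inner_smul_right, neg_zero, add_zero] at h3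
    have hne : deriv θ φ ≠ 0 := fun h0 => by simpa [h0] using hpos φ
    have h4 := eq_inner_smul_dir_add (γ ψ - γ φ) (θ φ)
    rw [z1, (mul_eq_zero.1 h3).resolve_left hne, zero_smul, zero_smul, add_zero] at h4
    exact (sub_eq_zero.1 h4).symm
  refine ⟨ε, θ, ⟨hε, hθ, hpos, fun φ => ?_⟩, hc, hd⟩
  have hder : deriv γ (φ + 2 * Real.pi) = deriv γ φ := by
    rw [← deriv_comp_add_const]
    congr 1
    exact funext h.periodic
  have hper : dir (θ (φ + 2 * Real.pi)) = dir (θ φ) := by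
    rw [← hn, ← hn]
    simp only [leftNormal, hder]
  obtain ⟨k, hk⟩ := dir_eq_dir hper
  have hπ := Real.pi_pos
  have m1 : ε * θ φ < ε * θ (φ + 2 * Real.pi) := hmono (by linarith)
  rw [hk] at m1
  have m2 : 0 < ε * k := by
    by_contra hcon
    nlinarith
  -- If the normal turned more than once, some `ψ` strictly inside the period would have the same
  -- normal as `φ`, hence the same point, against simplicity.
  have m3 : ¬ 1 < ε * k := by
    intro hk1
    have hmem : ε * θ φ + 2 * Real.pi ∈ Ioo (ε * θ φ) (ε * θ (φ + 2 * Real.pi)) := by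
      rw [hk]
      constructor
      · linarith
      · nlinarith
    obtain ⟨ψ, hψ, e⟩ := intermediate_value_Ioo (by linarith : φ ≤ φ + 2 * Real.pi)
      (continuous_const.mul hθ.continuous).continuousOn hmem
    have e' : θ ψ = θ φ + ε * (2 * Real.pi) := by
      have e0 : ε * θ ψ = ε * θ φ + 2 * Real.pi := e
      linear_combination ε * e0 + (θ φ - θ ψ) * hε2
    have hdir : dir (θ φ) = dir (θ ψ) := by
      rw [e']
      rcases hε with rfl | rfl
      · rw [one_mul]; exact (dir_periodic _).symm
      · rw [neg_one_mul]; exact (dir_periodic.sub_eq _).symm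
    exact h.not_eq hψ.1 hψ.2 (hsame φ ψ hdir)
  rw [hk]
  rcases hε with rfl | rfl
  · have a1 : (0 : ℝ) < k := by linarith
    have a2 : (k : ℝ) ≤ 1 := by linarith
    have a1' : 0 < k := by exact_mod_cast a1
    have a2' : k ≤ 1 := by exact_mod_cast a2
    have : k = 1 := by omega
    rw [this]; simp
  · have a1 : (k : ℝ) < 0 := by linarith
    have a2 : (-1 : ℝ) ≤ k := by linarith
    have a1' : k < 0 := by exact_mod_cast a1
    have a2' : -1 ≤ k := by exact_mod_cast a2
    have : k = -1 := by omega
    rw [this]; simp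

/-- The inverse function theorem applies to the increasing bijection `ε * θ`; as `ε² = 1`, its
inverse evaluated at `ε * α` serves for `θ`. -/
theorem IsAngle.exists_smooth_inverse {ε : ℝ} {θ : ℝ → ℝ} (h : IsAngle ε θ) :
    ∃ σ : ℝ → ℝ, ContDiff ℝ ∞ σ ∧ ∀ α, θ (σ α) = α := by
  have hε := h.mul_self
  have hsurj : Function.Surjective fun φ => ε * θ φ := fun y => by
    obtain ⟨φ, hφ⟩ := h.surjective (ε * y)
    exact ⟨φ, by simp only [hφ]; linear_combination y * hε⟩
  let f := (h.strictMono.orderIsoOfSurjective _ hsurj).toHomeomorph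
  have hf : ∀ φ, f φ = ε * θ φ := fun φ => rfl
  have hfs : ContDiff ℝ ∞ f.symm := f.contDiff_symm_deriv (f' := fun φ => ε * deriv θ φ)
    (fun φ => (h.deriv_pos φ).ne')
    (fun φ => (hasDerivAt_of_contDiff h.smooth φ).const_mul ε)
    (contDiff_const.mul h.smooth)
  refine ⟨fun α => f.symm (ε * α), hfs.comp (contDiff_const.mul contDiff_id), fun α => ?_⟩
  have := hf (f.symm (ε * α))
  rw [f.apply_symm_apply] at this
  linear_combination (-ε) * this + (α - θ (f.symm (ε * α))) * hε

/-- A strictly convex curve is determined by its smooth support function and its normal angle. -/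
theorem IsStrictlyConvexCurve.exists_support (h : IsStrictlyConvexCurve γ) :
    ContDiff ℝ ∞ (supportFun γ) ∧ Function.Periodic (supportFun γ) (2 * Real.pi) ∧
      (∀ α, 0 < radius (supportFun γ) α) ∧
      ∃ ε θ, IsAngle ε θ ∧ ∀ φ, γ φ = point (supportFun γ) (θ φ) := by
  obtain ⟨ε, θ, hθ, hc, hd⟩ := h.exists_isAngle
  obtain ⟨σ, hσ, hθσ⟩ := hθ.exists_smooth_inverse
  have hu : supportFun γ = fun α => ⟪γ (σ α), dir α⟫ := by
    funext α
    refine IsLUB.ciSup_eq (IsGreatest.isLUB ⟨⟨σ α, rfl⟩, ?_⟩)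
    rintro _ ⟨ψ, rfl⟩
    have := hc (σ α) ψ
    rw [hθσ, inner_sub_left] at this
    change ⟪γ ψ, dir α⟫ ≤ ⟪γ (σ α), dir α⟫
    linarith
  have hP : ContDiff ℝ ∞ (fun α => γ (σ α)) := h.smooth.comp hσ
  have hsm : ContDiff ℝ ∞ (supportFun γ) := by
    rw [hu]; exact hP.inner ℝ contDiff_dir
  have hper : Function.Periodic (supportFun γ) (2 * Real.pi) := fun α => by
    simp only [supportFun, dir_periodic α]
  -- The contact point moves tangentially, so its motion contributes nothing and only `dir` is
  -- differentiated.
  have hderiv : ∀ α, deriv (supportFun γ) α = ⟪γ (σ α), rot (dir α)⟫ := fun α => by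
    have h1 : HasDerivAt (fun α => γ (σ α)) (deriv σ α • deriv γ (σ α)) α :=
      (hasDerivAt_of_contDiff h.smooth (σ α)).scomp α (hasDerivAt_of_contDiff hσ α)
    have h2 := h1.inner ℝ (hasDerivAt_dir α)
    rw [hu, h2.deriv, hd, hθσ, real_inner_smul_left, real_inner_smul_left, inner_rot_self]
    ring
  have hpt : ∀ α, point (supportFun γ) α = γ (σ α) := fun α => by
    rw [point, hderiv, hu]
    exact (eq_inner_smul_dir_add (γ (σ α)) α).symm
  have hγ : ∀ φ, γ φ = point (supportFun γ) (θ φ) := fun φ => by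
    rw [hpt, hθ.injective (hθσ (θ φ))]
  refine ⟨hsm, hper, fun α => ?_, ε, θ, hθ, hγ⟩
  -- Two expressions for the velocity are compared: `ε θ' ρ = ‖γ'‖ > 0`, and `ε θ' > 0`.
  have h1 := (hasDerivAt_curve hsm hθ (σ α)).deriv
  rw [← funext hγ, hd, hθσ] at h1
  have h2 : ⟪(ε * ‖deriv γ (σ α)‖) • rot (dir α), rot (dir α)⟫
      = ⟪(deriv θ (σ α) * radius (supportFun γ) α) • rot (dir α), rot (dir α)⟫ := by rw [h1]
  rw [real_inner_smul_left, real_inner_smul_left, real_inner_self_eq_norm_sq, norm_rot,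
    norm_dir] at h2
  have h3 := norm_pos_iff.2 (h.regular (σ α))
  have h4 : ε * deriv θ (σ α) * radius (supportFun γ) α = ‖deriv γ (σ α)‖ := by
    linear_combination (-ε) * h2 + ‖deriv γ (σ α)‖ * hθ.mul_self
  exact (mul_pos_iff_of_pos_left (hθ.deriv_pos _)).1 (h4 ▸ h3)

end InitialCurve

/-! ### Fourier coefficients of smooth periodic functions, Fourier expansion and Parseval. -/

section Fourier

/-- A sequence, indexed from frequency one, that decays faster than every power. -/
def RapidDecay (a : ℕ → ℝ) : Prop := ∀ k : ℕ, ∃ C, ∀ n : ℕ, ((n : ℝ) + 1) ^ k * |a n| ≤ C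

theorem RapidDecay.summable_mul {a : ℕ → ℝ} (ha : RapidDecay a) (k : ℕ) :
    Summable fun n : ℕ => ((n : ℝ) + 1) ^ k * |a n| := by
  obtain ⟨C, hC⟩ := ha (k + 2)
  have hs : Summable fun n : ℕ => C * (1 / ((n : ℝ) + 1) ^ 2) := by
    refine Summable.mul_left C ?_
    have := (summable_nat_add_iff 1).2 (Real.summable_one_div_nat_pow.2 one_lt_two)
    simpa using this
  refine Summable.of_nonneg_of_le (fun n => by positivity) (fun n => ?_) hs
  have hn : (0 : ℝ) < (n : ℝ) + 1 := by positivity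
  rw [mul_one_div, le_div_iff₀ (by positivity)]
  calc ((n : ℝ) + 1) ^ k * |a n| * ((n : ℝ) + 1) ^ 2 = ((n : ℝ) + 1) ^ (k + 2) * |a n| := by ring
    _ ≤ C := hC n

theorem RapidDecay.summable_abs {a : ℕ → ℝ} (ha : RapidDecay a) : Summable fun n => |a n| := by
  simpa using ha.summable_mul 0

theorem RapidDecay.of_le {a b : ℕ → ℝ} (ha : RapidDecay a) (m : ℕ)
    (h : ∀ n : ℕ, |b n| ≤ ((n : ℝ) + 1) ^ m * |a n|) : RapidDecay b := fun k => by
  obtain ⟨C, hC⟩ := ha (k + m)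
  refine ⟨C, fun n => le_trans ?_ (hC n)⟩
  calc ((n : ℝ) + 1) ^ k * |b n| ≤ ((n : ℝ) + 1) ^ k * (((n : ℝ) + 1) ^ m * |a n|) := by
        gcongr; exact h n
    _ = _ := by ring

variable {f : ℝ → ℝ}

theorem cosCoeff_deriv (hf : ContDiff ℝ ∞ f) (hp : Function.Periodic f (2 * Real.pi)) (n : ℕ) :
    cosCoeff (deriv f) n = n * sinCoeff f n := by
  have hc : Continuous (deriv f) := (contDiff_deriv hf).continuous
  have hc' : Continuous f := hf.continuous
  have hz := integral_deriv_periodic (c := 2 * Real.pi) (f := fun θ => f θ * Real.cos (n * θ))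
    (f' := fun θ => deriv f θ * Real.cos (n * θ) - n * (f θ * Real.sin (n * θ))) (fun θ => by
      have h1 := (hasDerivAt_of_contDiff hf θ).mul
        (((hasDerivAt_id θ).const_mul (n : ℝ)).cos)
      convert! h1 using 1
      simp; ring) (by fun_prop)
    (fun θ => by simp only [hp θ, mul_add, Real.cos_add_nat_mul_two_pi])
  rw [intervalIntegral.integral_sub (Continuous.intervalIntegrable (by fun_prop) _ _)
    (Continuous.intervalIntegrable (by fun_prop) _ _), intervalIntegral.integral_const_mul] at hz
  rw [cosCoeff, sinCoeff]
  linear_combination (1 / Real.pi) * hz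

theorem sinCoeff_deriv (hf : ContDiff ℝ ∞ f) (hp : Function.Periodic f (2 * Real.pi)) (n : ℕ) :
    sinCoeff (deriv f) n = -(n * cosCoeff f n) := by
  have hc : Continuous (deriv f) := (contDiff_deriv hf).continuous
  have hc' : Continuous f := hf.continuous
  have hz := integral_deriv_periodic (c := 2 * Real.pi) (f := fun θ => f θ * Real.sin (n * θ))
    (f' := fun θ => deriv f θ * Real.sin (n * θ) + n * (f θ * Real.cos (n * θ))) (fun θ => by
      have h1 := (hasDerivAt_of_contDiff hf θ).mul
        (((hasDerivAt_id θ).const_mul (n : ℝ)).sin)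
      convert! h1 using 1
      simp; ring) (by fun_prop)
    (fun θ => by simp only [hp θ, mul_add, Real.sin_add_nat_mul_two_pi])
  rw [intervalIntegral.integral_add (Continuous.intervalIntegrable (by fun_prop) _ _)
    (Continuous.intervalIntegrable (by fun_prop) _ _), intervalIntegral.integral_const_mul] at hz
  rw [cosCoeff, sinCoeff]
  linear_combination (1 / Real.pi) * hz

theorem exists_coeff_bound (hf : Continuous f) :
    ∃ C, ∀ n, |cosCoeff f n| ≤ C ∧ |sinCoeff f n| ≤ C := by
  obtain ⟨B, hB⟩ := (isCompact_Icc (a := (0 : ℝ)) (b := 2 * Real.pi)).exists_bound_of_continuousOn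
    hf.continuousOn
  have hπ := Real.two_pi_pos
  have key : ∀ g : ℝ → ℝ, (∀ x, |g x| ≤ 1) →
      |(1 / Real.pi) * ∫ θ in (0 : ℝ)..2 * Real.pi, f θ * g θ|
        ≤ (1 / Real.pi) * (B * |2 * Real.pi - 0|) := by
    intro g hg
    rw [abs_mul, abs_of_pos (by positivity : 0 < 1 / Real.pi)]
    gcongr
    refine intervalIntegral.norm_integral_le_of_norm_le_const (f := fun θ => f θ * g θ)
      fun x hx => ?_
    rw [uIoc_of_le hπ.le] at hx
    have h1 := hB x (Ioc_subset_Icc_self hx)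
    rw [norm_mul]
    calc ‖f x‖ * ‖g x‖ ≤ ‖f x‖ * 1 := by gcongr; exact hg x
      _ ≤ B := by linarith
  exact ⟨_, fun n => ⟨key _ fun x => Real.abs_cos_le_one _, key _ fun x => Real.abs_sin_le_one _⟩⟩

/-- Each integration by parts trades one power of `n` for one derivative of `f`, swapping cosine and
sine coefficients. -/
theorem exists_coeff_pow_bound (k : ℕ) (hf : ContDiff ℝ ∞ f)
    (hp : Function.Periodic f (2 * Real.pi)) :
    ∃ C, ∀ n : ℕ, (n : ℝ) ^ k * |cosCoeff f n| ≤ C ∧ (n : ℝ) ^ k * |sinCoeff f n| ≤ C := by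
  induction k generalizing f with
  | zero => simpa using exists_coeff_bound hf.continuous
  | succ k ih =>
    obtain ⟨C, hC⟩ := ih (contDiff_deriv hf) (periodic_deriv hp)
    refine ⟨C, fun n => ?_⟩
    have h := hC n
    rw [cosCoeff_deriv hf hp, sinCoeff_deriv hf hp, abs_neg, abs_mul, abs_mul, Nat.abs_cast] at h
    rw [pow_succ, mul_assoc, mul_assoc]
    exact ⟨h.2, h.1⟩

theorem rapidDecay_cosCoeff (hf : ContDiff ℝ ∞ f) (hp : Function.Periodic f (2 * Real.pi)) :
    RapidDecay fun n => cosCoeff f (n + 1) := fun k => by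
  obtain ⟨C, hC⟩ := exists_coeff_pow_bound k hf hp
  exact ⟨C, fun n => by simpa using (hC (n + 1)).1⟩

theorem rapidDecay_sinCoeff (hf : ContDiff ℝ ∞ f) (hp : Function.Periodic f (2 * Real.pi)) :
    RapidDecay fun n => sinCoeff f (n + 1) := fun k => by
  obtain ⟨C, hC⟩ := exists_coeff_pow_bound k hf hp
  exact ⟨C, fun n => by simpa using (hC (n + 1)).2⟩

instance fact_two_pi_pos : Fact (0 < 2 * Real.pi) := ⟨Real.two_pi_pos⟩

theorem fourier_two_pi (m : ℤ) (x : ℝ) :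
    fourier m (x : AddCircle (2 * Real.pi)) = Complex.exp ((m * x : ℝ) * Complex.I) := by
  rw [fourier_coe_apply]
  congr 1
  have : (Real.pi : ℂ) ≠ 0 := by exact_mod_cast Real.pi_ne_zero
  push_cast
  field_simp

/-- A smooth periodic function is the sum of its Fourier series. -/
theorem hasSum_fourier (hf : ContDiff ℝ ∞ f) (hp : Function.Periodic f (2 * Real.pi)) (θ : ℝ) :
    HasSum (fun n : ℕ => cosCoeff f (n + 1) * Real.cos (((n : ℝ) + 1) * θ)
      + sinCoeff f (n + 1) * Real.sin (((n : ℝ) + 1) * θ)) (f θ - cosCoeff f 0 / 2) := by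
  have hfc : Continuous f := hf.continuous
  have hpc : Function.Periodic (fun x => (f x : ℂ)) (2 * Real.pi) := fun x => by
    simp only [hp x]
  let F : C(AddCircle (2 * Real.pi), ℂ) :=
    ⟨hpc.lift, continuous_coinduced_dom.2 (Complex.continuous_ofReal.comp hfc)⟩
  have hF : ∀ x : ℝ, F (x : AddCircle (2 * Real.pi)) = f x := fun x => hpc.lift_coe x
  have hcoeff : ∀ (m : ℤ), fourierCoeff F m
      = (1 / (2 * Real.pi) : ℝ) * (((∫ x in (0 : ℝ)..2 * Real.pi, f x * Real.cos (m * x) : ℝ) : ℂ)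
        - ((∫ x in (0 : ℝ)..2 * Real.pi, f x * Real.sin (m * x) : ℝ) : ℂ) * Complex.I) := by
    intro m
    rw [fourierCoeff_eq_intervalIntegral _ _ 0, zero_add, ← intervalIntegral.integral_ofReal,
      ← intervalIntegral.integral_ofReal, ← intervalIntegral.integral_mul_const,
      ← intervalIntegral.integral_sub (Continuous.intervalIntegrable (by fun_prop) _ _)
        (Continuous.intervalIntegrable (by fun_prop) _ _), Complex.real_smul]
    congr 1
    refine intervalIntegral.integral_congr fun x _ => ?_
    simp only [hF, fourier_two_pi, smul_eq_mul]
    rw [Complex.exp_mul_I]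
    push_cast
    rw [neg_mul, Complex.cos_neg, Complex.sin_neg]
    ring
  have hcos : ∀ n : ℕ, fourierCoeff F n = (1 / 2 : ℂ) * (cosCoeff f n - sinCoeff f n * Complex.I) := by
    intro n
    rw [hcoeff, cosCoeff, sinCoeff]
    push_cast
    have : (Real.pi : ℂ) ≠ 0 := by exact_mod_cast Real.pi_ne_zero
    field_simp
  have hsin : ∀ n : ℕ, fourierCoeff F (-n)
      = (1 / 2 : ℂ) * (cosCoeff f n + sinCoeff f n * Complex.I) := by
    intro n
    rw [hcoeff, cosCoeff, sinCoeff]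
    push_cast
    simp only [neg_mul, Real.cos_neg, Real.sin_neg, mul_neg, intervalIntegral.integral_neg]
    have : (Real.pi : ℂ) ≠ 0 := by exact_mod_cast Real.pi_ne_zero
    push_cast
    field_simp
    ring
  have hsc : Summable fun n : ℕ => |cosCoeff f n| :=
    (summable_nat_add_iff 1).1 (rapidDecay_cosCoeff hf hp).summable_abs
  have hss : Summable fun n : ℕ => |sinCoeff f n| :=
    (summable_nat_add_iff 1).1 (rapidDecay_sinCoeff hf hp).summable_abs
  have hsum : Summable (fourierCoeff F) := by
    refine Summable.of_nat_of_neg ?_ ?_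
    · refine Summable.of_norm_bounded (hsc.add hss) fun n => ?_
      rw [hcos, norm_mul]
      have := norm_sub_le (cosCoeff f n : ℂ) (sinCoeff f n * Complex.I)
      simp only [norm_mul, Complex.norm_real, Complex.norm_I, mul_one, Real.norm_eq_abs] at this
      norm_num
      linarith [norm_nonneg ((cosCoeff f n : ℂ) - sinCoeff f n * Complex.I)]
    · refine Summable.of_norm_bounded (hsc.add hss) fun n => ?_
      rw [hsin, norm_mul]
      have := norm_add_le (cosCoeff f n : ℂ) (sinCoeff f n * Complex.I)
      simp only [norm_mul, Complex.norm_real, Complex.norm_I, mul_one, Real.norm_eq_abs] at this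
      norm_num
      linarith [norm_nonneg ((cosCoeff f n : ℂ) + sinCoeff f n * Complex.I)]
  -- Pairing `n` with `-n` over all natural `n` counts frequency zero twice, so the sum is `f θ + a₀
  -- / 2`. Dropping the term `n = 0`, which is `a₀`, leaves `f θ - a₀ / 2`.
  have h1 := (has_pointwise_sum_fourier_series_of_summable hsum
    (θ : AddCircle (2 * Real.pi))).nat_add_neg
  have hterm : ∀ n : ℕ, fourierCoeff F n • fourier (n : ℤ) (θ : AddCircle (2 * Real.pi))
      + fourierCoeff F (-n) • fourier (-(n : ℤ)) (θ : AddCircle (2 * Real.pi))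
      = ((cosCoeff f n * Real.cos (n * θ) + sinCoeff f n * Real.sin (n * θ) : ℝ) : ℂ) := by
    intro n
    rw [hcos, hsin, fourier_two_pi, fourier_two_pi, Complex.exp_mul_I, Complex.exp_mul_I]
    push_cast
    rw [neg_mul, Complex.cos_neg, Complex.sin_neg, smul_eq_mul, smul_eq_mul]
    linear_combination (-(sinCoeff f n : ℂ) * Complex.sin (n * θ)) * Complex.I_sq
  simp only [hterm] at h1
  rw [hF] at h1
  have h0 : fourierCoeff F 0 • fourier 0 (θ : AddCircle (2 * Real.pi))
      = ((cosCoeff f 0 / 2 : ℝ) : ℂ) := by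
    have := hcos 0
    simp only [Nat.cast_zero] at this
    rw [this, fourier_two_pi]
    have hs0 : sinCoeff f 0 = 0 := by simp [sinCoeff]
    simp [hs0]
    ring
  rw [h0, ← Complex.ofReal_add] at h1
  have h2 := (hasSum_nat_add_iff' 1).2 (Complex.hasSum_ofReal.1 h1)
  convert! h2 using 1
  · funext n; push_cast; rfl
  · simp; ring

/-! ### Trigonometric series -/

theorem integral_cos_int_mul {k : ℤ} (hk : k ≠ 0) :
    ∫ x in (0 : ℝ)..2 * Real.pi, Real.cos (k * x) = 0 := by
  have hk' : (k : ℝ) ≠ 0 := by exact_mod_cast hk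
  rw [intervalIntegral.integral_comp_mul_left (fun x => Real.cos x) hk', integral_cos]
  simp [← mul_assoc]
  right
  have := Real.sin_int_mul_pi (k * 2)
  push_cast at this
  exact this

theorem integral_sin_int_mul (k : ℤ) :
    ∫ x in (0 : ℝ)..2 * Real.pi, Real.sin (k * x) = 0 := by
  rcases eq_or_ne k 0 with rfl | hk
  · simp
  have hk' : (k : ℝ) ≠ 0 := by exact_mod_cast hk
  rw [intervalIntegral.integral_comp_mul_left (fun x => Real.sin x) hk', integral_sin]
  have := Real.cos_int_mul_two_pi k
  simp [this]

/-- The pure oscillation of frequency `n + 1`. -/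
noncomputable def mode (A B : ℕ → ℝ) (n : ℕ) (θ : ℝ) : ℝ :=
  A n * Real.cos (((n : ℝ) + 1) * θ) + B n * Real.sin (((n : ℝ) + 1) * θ)

theorem continuous_mode (A B : ℕ → ℝ) (n : ℕ) : Continuous (mode A B n) := by
  unfold mode; fun_prop

theorem integral_mode (A B : ℕ → ℝ) (n : ℕ) : ∫ x in (0 : ℝ)..2 * Real.pi, mode A B n x = 0 := by
  have h1 := integral_cos_int_mul (k := (n : ℤ) + 1) (by omega)
  have h2 := integral_sin_int_mul ((n : ℤ) + 1)
  push_cast at h1 h2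
  simp only [mode]
  rw [intervalIntegral.integral_add (Continuous.intervalIntegrable (by fun_prop) _ _)
    (Continuous.intervalIntegrable (by fun_prop) _ _), intervalIntegral.integral_const_mul,
    intervalIntegral.integral_const_mul, h1, h2]
  ring

theorem integral_mode_mul_mode (A B : ℕ → ℝ) (m n : ℕ) :
    ∫ x in (0 : ℝ)..2 * Real.pi, mode A B m x * mode A B n x
      = if m = n then Real.pi * (A n ^ 2 + B n ^ 2) else 0 := by
  have e : ∀ x, mode A B m x * mode A B n x
      = (A m * A n + B m * B n) / 2 * Real.cos (((m : ℤ) - (n : ℤ) : ℤ) * x)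
        + (A m * A n - B m * B n) / 2 * Real.cos (((m : ℤ) + 1 + ((n : ℤ) + 1) : ℤ) * x)
        + (B m * A n - A m * B n) / 2 * Real.sin (((m : ℤ) - (n : ℤ) : ℤ) * x)
        + (B m * A n + A m * B n) / 2 * Real.sin (((m : ℤ) + 1 + ((n : ℤ) + 1) : ℤ) * x) := by
    intro x
    have d1 : (((m : ℤ) - (n : ℤ) : ℤ) : ℝ) * x = ((m : ℝ) + 1) * x - ((n : ℝ) + 1) * x := by
      push_cast; ring
    have d2 : (((m : ℤ) + 1 + ((n : ℤ) + 1) : ℤ) : ℝ) * x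
        = ((m : ℝ) + 1) * x + ((n : ℝ) + 1) * x := by push_cast; ring
    rw [d1, d2, Real.cos_sub, Real.cos_add, Real.sin_sub, Real.sin_add]
    simp only [mode]
    ring
  simp only [e]
  rw [intervalIntegral.integral_add (Continuous.intervalIntegrable (by fun_prop) _ _)
    (Continuous.intervalIntegrable (by fun_prop) _ _),
    intervalIntegral.integral_add (Continuous.intervalIntegrable (by fun_prop) _ _)
    (Continuous.intervalIntegrable (by fun_prop) _ _),
    intervalIntegral.integral_add (Continuous.intervalIntegrable (by fun_prop) _ _)
    (Continuous.intervalIntegrable (by fun_prop) _ _)]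
  simp only [intervalIntegral.integral_const_mul]
  rw [integral_sin_int_mul, integral_sin_int_mul, integral_cos_int_mul
    (k := (m : ℤ) + 1 + ((n : ℤ) + 1)) (by omega)]
  split_ifs with h
  · subst h; simp; ring
  · rw [integral_cos_int_mul (by omega)]; simp

theorem abs_mode_le (A B : ℕ → ℝ) (n : ℕ) (x : ℝ) : |mode A B n x| ≤ |A n| + |B n| := by
  refine (abs_add_le _ _).trans (add_le_add ?_ ?_) <;> rw [abs_mul]
  · exact mul_le_of_le_one_right (abs_nonneg _) (Real.abs_cos_le_one _)
  · exact mul_le_of_le_one_right (abs_nonneg _) (Real.abs_sin_le_one _)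

variable {A B : ℕ → ℝ} {w : ℝ → ℝ}

theorem hasSum_integral_mode_mul (hA : Summable fun n => |A n|) (hB : Summable fun n => |B n|)
    (hw : ∀ x, HasSum (fun n => mode A B n x) (w x)) {g : ℝ → ℝ} (hg : Continuous g) :
    HasSum (fun n => ∫ x in (0 : ℝ)..2 * Real.pi, mode A B n x * g x)
      (∫ x in (0 : ℝ)..2 * Real.pi, w x * g x) := by
  refine intervalIntegral.hasSum_integral_of_dominated_convergence
    (fun n x => (|A n| + |B n|) * |g x|) (fun n => ?_) (fun n => ?_) ?_ ?_ ?_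
  · exact ((continuous_mode A B n).mul hg).aestronglyMeasurable
  · refine Eventually.of_forall fun x _ => ?_
    rw [norm_mul]
    exact mul_le_mul_of_nonneg_right (abs_mode_le A B n x) (abs_nonneg _)
  · exact Eventually.of_forall fun x _ => (hA.add hB).mul_right _
  · simp only [tsum_mul_right]
    exact (continuous_const.mul hg.abs).intervalIntegrable _ _
  · exact Eventually.of_forall fun x _ => (hw x).mul_right _

theorem integral_eq_zero_of_hasSum_mode (hA : Summable fun n => |A n|)
    (hB : Summable fun n => |B n|) (hw : ∀ x, HasSum (fun n => mode A B n x) (w x)) :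
    ∫ x in (0 : ℝ)..2 * Real.pi, w x = 0 := by
  have h := hasSum_integral_mode_mul hA hB hw (g := fun _ => 1) continuous_const
  simp only [mul_one, integral_mode] at h
  exact h.unique hasSum_zero

/-- Parseval's identity for an absolutely convergent trigonometric series without constant
term. -/
theorem hasSum_sq_of_hasSum_mode (hA : Summable fun n => |A n|)
    (hB : Summable fun n => |B n|) (hw : ∀ x, HasSum (fun n => mode A B n x) (w x))
    (hwc : Continuous w) :
    HasSum (fun n => Real.pi * (A n ^ 2 + B n ^ 2)) (∫ x in (0 : ℝ)..2 * Real.pi, w x ^ 2) := by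
  have h := hasSum_integral_mode_mul hA hB hw hwc
  -- Termwise integration is used twice: against one mode, where orthogonality leaves a single term,
  -- and against `w` itself.
  have e : ∀ n, ∫ x in (0 : ℝ)..2 * Real.pi, mode A B n x * w x
      = Real.pi * (A n ^ 2 + B n ^ 2) := by
    intro n
    have h1 := hasSum_integral_mode_mul hA hB hw (continuous_mode A B n)
    simp only [integral_mode_mul_mode] at h1
    have h2 := h1.unique (hasSum_ite_eq n (Real.pi * (A n ^ 2 + B n ^ 2)))
    rw [← h2]
    exact intervalIntegral.integral_congr fun x _ => mul_comm _ _
  simp only [e] at h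
  simpa only [sq] using h

end Fourier

/-! ### Series with exponentially damped modes and their smoothness. -/

section HeatSeries

/-- A smooth function on the line with all derivatives bounded. -/
structure BoundedDerivs (h : ℝ → ℝ) : Prop where
  smooth : ContDiff ℝ ∞ h
  bound : ∀ k : ℕ, ∃ C, ∀ s, |iteratedDeriv k h s| ≤ C

theorem BoundedDerivs.deriv {h : ℝ → ℝ} (hh : BoundedDerivs h) : BoundedDerivs (deriv h) where
  smooth := contDiff_deriv hh.smooth
  bound k := by
    obtain ⟨C, hC⟩ := hh.bound (k + 1)
    exact ⟨C, fun s => by rw [← iteratedDeriv_succ']; exact hC s⟩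

theorem boundedDerivs_cos : BoundedDerivs Real.cos :=
  ⟨Real.contDiff_cos, fun k => ⟨1, Real.abs_iteratedDeriv_cos_le_one k⟩⟩

theorem boundedDerivs_sin : BoundedDerivs Real.sin :=
  ⟨Real.contDiff_sin, fun k => ⟨1, Real.abs_iteratedDeriv_sin_le_one k⟩⟩

/-- The exponential `exp (-s)`, cut off smoothly for negative `s`. -/
noncomputable def cutExp (s : ℝ) : ℝ := Real.smoothTransition (s + 2) * Real.exp (-s)

theorem cutExp_of_ge {s : ℝ} (hs : -1 ≤ s) : cutExp s = Real.exp (-s) := by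
  rw [cutExp, Real.smoothTransition.one_of_one_le (by linarith), one_mul]

theorem cutExp_of_le {s : ℝ} (hs : s ≤ -2) : cutExp s = 0 := by
  rw [cutExp, Real.smoothTransition.zero_of_nonpos (by linarith), zero_mul]

theorem contDiff_cutExp : ContDiff ℝ ∞ cutExp :=
  (Real.smoothTransition.contDiff.comp (contDiff_id.add contDiff_const)).mul
    (Real.contDiff_exp.comp contDiff_neg)

theorem eventually_cutExp_eq {s : ℝ} (hs : -1 < s) : cutExp =ᶠ[𝓝 s] fun s => Real.exp (-1 * s) := by
  filter_upwards [lt_mem_nhds hs] with r hr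
  rw [cutExp_of_ge hr.le, neg_one_mul]

/-- For negative time the factors `exp (-rate n * t)` blow up. The cut-off bounds all derivatives on
the whole line, so the series is smooth across `t = 0`, while nothing changes for `t ≥ 0`. The bound
is zero below `-2`, compactness up to `-1`, and `exp 1` beyond. -/
theorem boundedDerivs_cutExp : BoundedDerivs cutExp := by
  refine ⟨contDiff_cutExp, fun k => ?_⟩
  have hc : Continuous (iteratedDeriv k cutExp) :=
    contDiff_cutExp.continuous_iteratedDeriv k (by exact_mod_cast le_top)
  obtain ⟨C, hC⟩ := (isCompact_Icc (a := (-2 : ℝ)) (b := -1)).exists_bound_of_continuousOn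
    hc.continuousOn
  refine ⟨max C (Real.exp 1), fun s => ?_⟩
  rcases lt_or_ge s (-2) with h1 | h1
  · have he : cutExp =ᶠ[𝓝 s] fun _ => (0 : ℝ) := by
      filter_upwards [gt_mem_nhds h1] with r hr
      exact cutExp_of_le (le_of_lt hr)
    rw [he.iteratedDeriv_eq]
    simp
    right
    positivity
  rcases le_or_gt s (-1) with h2 | h2
  · exact (hC s ⟨h1, h2⟩).trans (le_max_left _ _)
  · rw [(eventually_cutExp_eq h2).iteratedDeriv_eq, iteratedDeriv_exp_const_mul]
    refine le_trans ?_ (le_max_right _ _)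
    simp only [abs_mul, abs_pow, abs_neg, abs_one, one_pow, one_mul, Real.abs_exp]
    exact Real.exp_le_exp.2 (by linarith)

theorem deriv_cutExp {s : ℝ} (hs : 0 ≤ s) : deriv cutExp s = -cutExp s := by
  rw [(eventually_cutExp_eq (by linarith)).deriv_eq, cutExp_of_ge (by linarith)]
  have h : HasDerivAt (fun s : ℝ => Real.exp (-1 * s)) (Real.exp (-1 * s) * (-1 * 1)) s :=
    ((hasDerivAt_id s).const_mul (-1)).exp
  rw [h.deriv]
  simp

variable {H c : ℝ → ℝ} {a : ℕ → ℝ}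

/-- The rate `(n + 1)² - 1`. -/
noncomputable def rate (n : ℕ) : ℝ := ((n : ℝ) + 1) ^ 2 - 1

theorem rate_nonneg (n : ℕ) : 0 ≤ rate n := by
  have : (0 : ℝ) ≤ n := n.cast_nonneg
  unfold rate; nlinarith

theorem rate_le (n : ℕ) : rate n ≤ ((n : ℝ) + 1) ^ 2 := by unfold rate; linarith

/-- One term of `modeSeries`. -/
noncomputable def modeTerm (H c : ℝ → ℝ) (a : ℕ → ℝ) (n : ℕ) (θ t : ℝ) : ℝ :=
  a n * (H (rate n * t) * c (((n : ℝ) + 1) * θ))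

/-- The series `∑ aₙ H(((n + 1)² - 1) t) c((n + 1) θ)`. -/
noncomputable def modeSeries (H c : ℝ → ℝ) (a : ℕ → ℝ) (θ t : ℝ) : ℝ := ∑' n, modeTerm H c a n θ t

theorem contDiff_modeTerm (hH : ContDiff ℝ ∞ H) (hc : ContDiff ℝ ∞ c) (n : ℕ) :
    ContDiff ℝ ∞ (fun p : ℝ × ℝ => modeTerm H c a n p.1 p.2) :=
  contDiff_const.mul ((hH.comp (contDiff_const.mul contDiff_snd)).mul
    (hc.comp (contDiff_const.mul contDiff_fst)))

theorem norm_iteratedFDeriv_comp_clm_le {h : ℝ → ℝ} (hh : ContDiff ℝ ∞ h) {k : ℕ} {C : ℝ}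
    (hC : ∀ s, |iteratedDeriv k h s| ≤ C) (L : ℝ × ℝ →L[ℝ] ℝ) {r : ℝ} (hL : ‖L‖ ≤ r)
    (p : ℝ × ℝ) : ‖iteratedFDeriv ℝ k (fun p => h (L p)) p‖ ≤ C * r ^ k := by
  have e := L.iteratedFDeriv_comp_right hh p (i := k) (by exact_mod_cast le_top)
  have e' : iteratedFDeriv ℝ k (fun p => h (L p)) p = _ := e
  have hC0 : 0 ≤ C := (abs_nonneg _).trans (hC 0)
  rw [e']
  refine (ContinuousMultilinearMap.norm_compContinuousLinearMap_le _ _).trans ?_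
  rw [norm_iteratedFDeriv_eq_norm_iteratedDeriv, Finset.prod_const, Finset.card_univ,
    Fintype.card_fin]
  gcongr
  exact hC _

/-- A time derivative costs at most the square of the frequency and an angle derivative costs the
frequency; the exponent `3 * k` is a generous bound for `k` of them. The constant does not depend on
`a`, so it also serves the coefficients of the differentiated series. -/
theorem exists_modeTerm_bound (hH : BoundedDerivs H) (hc : BoundedDerivs c) (k : ℕ) :
    ∃ C, ∀ (a : ℕ → ℝ) (n : ℕ) (p : ℝ × ℝ),
      ‖iteratedFDeriv ℝ k (fun p : ℝ × ℝ => modeTerm H c a n p.1 p.2) p‖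
        ≤ C * (((n : ℝ) + 1) ^ (3 * k) * |a n|) := by
  choose CH hCH using hH.bound
  choose Cc hCc using hc.bound
  have hCH0 : ∀ i, 0 ≤ CH i := fun i => (abs_nonneg _).trans (hCH i 0)
  have hCc0 : ∀ i, 0 ≤ Cc i := fun i => (abs_nonneg _).trans (hCc i 0)
  refine ⟨∑ i ∈ Finset.range (k + 1), (k.choose i : ℝ) * CH i * Cc (k - i), fun a n p => ?_⟩
  set N : ℝ := (n : ℝ) + 1 with hN
  have hN1 : 1 ≤ N := by
    have : (0 : ℝ) ≤ n := n.cast_nonneg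
    linarith
  let L1 : ℝ × ℝ →L[ℝ] ℝ := rate n • ContinuousLinearMap.snd ℝ ℝ ℝ
  let L2 : ℝ × ℝ →L[ℝ] ℝ := N • ContinuousLinearMap.fst ℝ ℝ ℝ
  have hL1 : ‖L1‖ ≤ N ^ 2 := by
    refine (norm_smul (rate n) (ContinuousLinearMap.snd ℝ ℝ ℝ)).le.trans ?_
    rw [Real.norm_of_nonneg (rate_nonneg n)]
    have := ContinuousLinearMap.norm_snd_le ℝ ℝ ℝ
    nlinarith [rate_nonneg n, rate_le n, norm_nonneg (ContinuousLinearMap.snd ℝ ℝ ℝ)]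
  have hL2 : ‖L2‖ ≤ N := by
    refine (norm_smul N (ContinuousLinearMap.fst ℝ ℝ ℝ)).le.trans ?_
    rw [Real.norm_of_nonneg (by linarith)]
    have := ContinuousLinearMap.norm_fst_le ℝ ℝ ℝ
    nlinarith [norm_nonneg (ContinuousLinearMap.fst ℝ ℝ ℝ)]
  have h1 : ContDiff ℝ ∞ (fun p : ℝ × ℝ => H (L1 p)) := hH.smooth.comp L1.contDiff
  have h2 : ContDiff ℝ ∞ (fun p : ℝ × ℝ => c (L2 p)) := hc.smooth.comp L2.contDiff
  have e : (fun p : ℝ × ℝ => modeTerm H c a n p.1 p.2)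
      = a n • fun p : ℝ × ℝ => H (L1 p) * c (L2 p) := by
    funext p; simp [modeTerm, L1, L2, hN]
  have hk : (k : WithTop ℕ∞) ≤ ∞ := by exact_mod_cast le_top
  rw [e, iteratedFDeriv_const_smul_apply ((h1.mul h2).contDiffAt.of_le hk), norm_smul,
    Real.norm_eq_abs]
  have hmul := norm_iteratedFDeriv_mul_le h1 h2 p (n := k) hk
  have hsum : ‖iteratedFDeriv ℝ k (fun p : ℝ × ℝ => H (L1 p) * c (L2 p)) p‖
      ≤ (∑ i ∈ Finset.range (k + 1), (k.choose i : ℝ) * CH i * Cc (k - i)) * N ^ (3 * k) := by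
    refine hmul.trans ?_
    rw [Finset.sum_mul]
    refine Finset.sum_le_sum fun i hi => ?_
    have hik : i ≤ k := Nat.lt_succ_iff.1 (Finset.mem_range.1 hi)
    have b1 := norm_iteratedFDeriv_comp_clm_le hH.smooth (hCH i) L1 hL1 p
    have b2 := norm_iteratedFDeriv_comp_clm_le hc.smooth (hCc (k - i)) L2 hL2 p
    calc (k.choose i : ℝ) * ‖iteratedFDeriv ℝ i (fun p : ℝ × ℝ => H (L1 p)) p‖
          * ‖iteratedFDeriv ℝ (k - i) (fun p : ℝ × ℝ => c (L2 p)) p‖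
        ≤ (k.choose i : ℝ) * (CH i * (N ^ 2) ^ i) * (Cc (k - i) * N ^ (k - i)) := by
          have := hCH0 i
          gcongr
      _ = (k.choose i : ℝ) * CH i * Cc (k - i) * N ^ (2 * i + (k - i)) := by
          rw [pow_add, pow_mul]; ring
      _ ≤ (k.choose i : ℝ) * CH i * Cc (k - i) * N ^ (3 * k) := by
          have := hCH0 i
          have := hCc0 (k - i)
          refine mul_le_mul_of_nonneg_left (pow_le_pow_right₀ hN1 (by omega)) ?_
          positivity
  calc |a n| * ‖iteratedFDeriv ℝ k (fun p : ℝ × ℝ => H (L1 p) * c (L2 p)) p‖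
      ≤ |a n| * ((∑ i ∈ Finset.range (k + 1), (k.choose i : ℝ) * CH i * Cc (k - i))
          * N ^ (3 * k)) := by gcongr
    _ = _ := by ring

theorem contDiff_modeSeries (hH : BoundedDerivs H) (hc : BoundedDerivs c) (ha : RapidDecay a) :
    ContDiff ℝ ∞ (fun p : ℝ × ℝ => modeSeries H c a p.1 p.2) := by
  choose C hC using exists_modeTerm_bound hH hc
  exact contDiff_tsum (v := fun k (n : ℕ) => C k * (((n : ℝ) + 1) ^ (3 * k) * |a n|))
    (contDiff_modeTerm hH.smooth hc.smooth) (fun k _ => (ha.summable_mul (3 * k)).mul_left (C k))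
    (fun k n p _ => hC k a n p)

theorem exists_abs_modeTerm_le (hH : BoundedDerivs H) (hc : BoundedDerivs c) :
    ∃ C, ∀ (a : ℕ → ℝ) (n : ℕ) (θ t : ℝ), |modeTerm H c a n θ t| ≤ C * |a n| := by
  obtain ⟨C, hC⟩ := exists_modeTerm_bound hH hc 0
  refine ⟨C, fun a n θ t => ?_⟩
  have := hC a n (θ, t)
  simpa using this

theorem hasSum_modeSeries (hH : BoundedDerivs H) (hc : BoundedDerivs c) (ha : RapidDecay a)
    (θ t : ℝ) : HasSum (fun n => modeTerm H c a n θ t) (modeSeries H c a θ t) := by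
  obtain ⟨C, hC⟩ := exists_abs_modeTerm_le hH hc
  exact (Summable.of_norm_bounded (ha.summable_abs.mul_left C) fun n => hC a n θ t).hasSum

theorem RapidDecay.freq_mul (ha : RapidDecay a) : RapidDecay fun n => ((n : ℝ) + 1) * a n :=
  ha.of_le 1 fun n => by
    rw [abs_mul, pow_one, abs_of_pos (by positivity : (0 : ℝ) < (n : ℝ) + 1)]

theorem RapidDecay.rate_mul (ha : RapidDecay a) : RapidDecay fun n => rate n * a n :=
  ha.of_le 2 fun n => by
    rw [abs_mul, abs_of_nonneg (rate_nonneg n)]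
    gcongr
    exact rate_le n

theorem hasDerivAt_modeSeries_angle (hH : BoundedDerivs H) (hc : BoundedDerivs c)
    (ha : RapidDecay a) (θ t : ℝ) : HasDerivAt (fun θ => modeSeries H c a θ t)
      (modeSeries H (deriv c) (fun n => ((n : ℝ) + 1) * a n) θ t) θ := by
  obtain ⟨C, hC⟩ := exists_abs_modeTerm_le hH hc.deriv
  refine hasDerivAt_tsum (g := fun n θ => modeTerm H c a n θ t)
    (g' := fun n θ => modeTerm H (deriv c) (fun n => ((n : ℝ) + 1) * a n) n θ t)
    (ha.freq_mul.summable_abs.mul_left C) (fun n θ => ?_) (fun n θ => hC _ n θ t)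
    (hasSum_modeSeries hH hc ha 0 t).summable θ
  have h1 : HasDerivAt (fun θ => ((n : ℝ) + 1) * θ) ((n : ℝ) + 1) θ := by
    simpa using (hasDerivAt_id θ).const_mul ((n : ℝ) + 1)
  have h2 := (hasDerivAt_of_contDiff hc.smooth (((n : ℝ) + 1) * θ)).comp θ h1
  convert! (h2.const_mul (H (rate n * t))).const_mul (a n) using 1
  simp only [modeTerm]
  ring

theorem hasDerivAt_modeSeries_time (hH : BoundedDerivs H) (hc : BoundedDerivs c)
    (ha : RapidDecay a) (θ t : ℝ) : HasDerivAt (fun t => modeSeries H c a θ t)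
      (modeSeries (deriv H) c (fun n => rate n * a n) θ t) t := by
  obtain ⟨C, hC⟩ := exists_abs_modeTerm_le hH.deriv hc
  refine hasDerivAt_tsum (g := fun n t => modeTerm H c a n θ t)
    (g' := fun n t => modeTerm (deriv H) c (fun n => rate n * a n) n θ t)
    (ha.rate_mul.summable_abs.mul_left C) (fun n t => ?_) (fun n t => hC _ n θ t)
    (hasSum_modeSeries hH hc ha θ 0).summable t
  have h1 : HasDerivAt (fun t => rate n * t) (rate n) t := by
    simpa using (hasDerivAt_id t).const_mul (rate n)
  have h2 := (hasDerivAt_of_contDiff hH.smooth (rate n * t)).comp t h1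
  convert! (h2.mul_const (c (((n : ℝ) + 1) * θ))).const_mul (a n) using 1
  simp only [modeTerm]
  ring

/-- For an oscillation `c'' = -c` the series solves `w_t = w_θθ + w` for nonnegative times. -/
theorem modeSeries_heat (hc : BoundedDerivs c) (hcc : ∀ x, deriv (deriv c) x = -c x)
    (ha : RapidDecay a) (θ : ℝ) {t : ℝ} (ht : 0 ≤ t) :
    deriv (fun t => modeSeries cutExp c a θ t) t
      = radius (fun θ => modeSeries cutExp c a θ t) θ := by
  have hH := boundedDerivs_cutExp
  rw [(hasDerivAt_modeSeries_time hH hc ha θ t).deriv, radius,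
    funext fun θ => (hasDerivAt_modeSeries_angle hH hc ha θ t).deriv,
    (hasDerivAt_modeSeries_angle hH hc.deriv ha.freq_mul θ t).deriv, modeSeries, modeSeries,
    modeSeries, ← (hasSum_modeSeries hH hc.deriv.deriv ha.freq_mul.freq_mul θ t).summable.tsum_add
      (hasSum_modeSeries hH hc ha θ t).summable]
  refine tsum_congr fun n => ?_
  simp only [modeTerm, hcc, deriv_cutExp (mul_nonneg (rate_nonneg n) ht)]
  have hr : rate n = ((n : ℝ) + 1) ^ 2 - 1 := rfl
  linear_combination (-(a n * cutExp (rate n * t) * c (((n : ℝ) + 1) * θ))) * hr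

end HeatSeries

theorem contDiff_radius_param {f : ℝ → ℝ → ℝ} (hf : ContDiff ℝ ∞ (fun p : ℝ × ℝ => f p.1 p.2)) :
    ContDiff ℝ ∞ (fun p : ℝ × ℝ => radius (fun α => f α p.2) p.1) := by
  have h1 : ContDiff ℝ ∞ (fun p : ℝ × ℝ => deriv (fun y => f y p.2) p.1) := contDiff_deriv_fst hf
  have h2 : ContDiff ℝ ∞ (fun p : ℝ × ℝ => deriv (fun y => deriv (fun z => f z p.2) y) p.1) :=
    contDiff_deriv_fst (f := fun y t => deriv (fun z => f z t) y) h1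
  exact h2.add hf

/-! ### The explicit solution of the support function equation. -/

section Evolution

theorem radius_add {u v : ℝ → ℝ} (hu : ContDiff ℝ ∞ u) (hv : ContDiff ℝ ∞ v) (θ : ℝ) :
    radius (fun α => u α + v α) θ = radius u θ + radius v θ := by
  have h1 : deriv (fun α => u α + v α) = fun α => deriv u α + deriv v α :=
    funext fun α => ((hasDerivAt_of_contDiff hu α).add (hasDerivAt_of_contDiff hv α)).deriv
  have h2 : deriv (fun α => deriv u α + deriv v α) θ = deriv (deriv u) θ + deriv (deriv v) θ :=
    ((hasDerivAt_of_contDiff (contDiff_deriv hu) θ).add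
      (hasDerivAt_of_contDiff (contDiff_deriv hv) θ)).deriv
  rw [radius, h1, h2, radius, radius]
  ring

theorem radius_const_add {v : ℝ → ℝ} (hv : ContDiff ℝ ∞ v) (k θ : ℝ) :
    radius (fun α => k + v α) θ = k + radius v θ := by
  rw [radius_add contDiff_const hv]
  simp [radius]

theorem hasDerivAt_integral_param {f : ℝ → ℝ → ℝ}
    (hf : ContDiff ℝ ∞ (fun p : ℝ × ℝ => f p.1 p.2)) (a b t : ℝ) :
    HasDerivAt (fun t => ∫ x in a..b, f x t) (∫ x in a..b, deriv (fun s => f x s) t) t := by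
  have hg : ContDiff ℝ ∞ (fun q : ℝ × ℝ => f q.2 q.1) := hf.comp (contDiff_snd.prodMk contDiff_fst)
  have hg1 : ContDiff ℝ 1 (fun q : ℝ × ℝ => f q.2 q.1) := hg.of_le (by simp)
  have h1 := (hasFDerivAt_intervalIntegral hg1 a b t).hasDerivAt
  have hc : Continuous fun s : ℝ => (fderiv ℝ (fun q : ℝ × ℝ => f q.2 q.1) (t, s)).comp
      (ContinuousLinearMap.inl ℝ ℝ ℝ) :=
    ((hg1.continuous_fderiv one_ne_zero).comp (by fun_prop : Continuous fun s : ℝ => (t, s))).clm_comp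
      continuous_const
  rw [ContinuousLinearMap.intervalIntegral_apply (hc.intervalIntegrable _ _)] at h1
  convert! h1 using 1
  refine intervalIntegral.integral_congr fun x _ => ?_
  exact (hasDerivAt_fst (f := fun s x => f x s) hg t x).deriv

theorem contDiff_integral_param {f : ℝ → ℝ → ℝ}
    (hf : ContDiff ℝ ∞ (fun p : ℝ × ℝ => f p.1 p.2)) (a b : ℝ) :
    ContDiff ℝ ∞ (fun t => ∫ x in a..b, f x t) :=
  contDiff_intervalIntegral (f := fun q : ℝ × ℝ => f q.2 q.1)
    (hf.comp (contDiff_snd.prodMk contDiff_fst)) a b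

/-- The part of positive frequency of the solution with initial value `u₀`, extended smoothly to
negative times. -/
noncomputable def oscillation (u₀ : ℝ → ℝ) (θ t : ℝ) : ℝ :=
  modeSeries cutExp Real.cos (fun n => cosCoeff u₀ (n + 1)) θ t
    + modeSeries cutExp Real.sin (fun n => sinCoeff u₀ (n + 1)) θ t

/-- The square integral of the oscillation. -/
noncomputable def energy (u₀ : ℝ → ℝ) (t : ℝ) : ℝ :=
  ∫ θ in (0 : ℝ)..2 * Real.pi, oscillation u₀ θ t ^ 2

/-- The square of the coefficient of frequency zero of the solution. -/
noncomputable def meanSq (u₀ : ℝ → ℝ) (t : ℝ) : ℝ :=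
  cosCoeff u₀ 0 ^ 2 + 2 * ((energy u₀ 0 - energy u₀ t) / Real.pi)

variable {u₀ : ℝ → ℝ} (hu : ContDiff ℝ ∞ u₀) (hp : Function.Periodic u₀ (2 * Real.pi))

section
include hu hp

theorem contDiff_oscillation : ContDiff ℝ ∞ (fun p : ℝ × ℝ => oscillation u₀ p.1 p.2) :=
  (contDiff_modeSeries boundedDerivs_cutExp boundedDerivs_cos (rapidDecay_cosCoeff hu hp)).add
    (contDiff_modeSeries boundedDerivs_cutExp boundedDerivs_sin (rapidDecay_sinCoeff hu hp))

theorem contDiff_oscillation_angle (t : ℝ) : ContDiff ℝ ∞ (fun θ => oscillation u₀ θ t) :=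
  (contDiff_oscillation hu hp).comp (contDiff_id.prodMk contDiff_const)

theorem hasSum_oscillation (θ t : ℝ) :
    HasSum (fun n => mode (fun n => cutExp (rate n * t) * cosCoeff u₀ (n + 1))
      (fun n => cutExp (rate n * t) * sinCoeff u₀ (n + 1)) n θ) (oscillation u₀ θ t) := by
  convert! (hasSum_modeSeries boundedDerivs_cutExp boundedDerivs_cos
    (rapidDecay_cosCoeff hu hp) θ t).add (hasSum_modeSeries boundedDerivs_cutExp
    boundedDerivs_sin (rapidDecay_sinCoeff hu hp) θ t) using 1
  funext n
  simp only [mode, modeTerm]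
  ring

theorem periodic_oscillation (t : ℝ) :
    Function.Periodic (fun θ => oscillation u₀ θ t) (2 * Real.pi) := fun θ => by
  refine (hasSum_oscillation hu hp (θ + 2 * Real.pi) t).unique ?_
  convert! hasSum_oscillation hu hp θ t using 1
  funext n
  have h : ((n : ℝ) + 1) * (θ + 2 * Real.pi)
      = ((n : ℝ) + 1) * θ + ((n + 1 : ℕ) : ℝ) * (2 * Real.pi) := by push_cast; ring
  simp only [mode, h, Real.cos_add_nat_mul_two_pi, Real.sin_add_nat_mul_two_pi]

theorem oscillation_zero (θ : ℝ) : oscillation u₀ θ 0 = u₀ θ - cosCoeff u₀ 0 / 2 := by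
  refine (hasSum_oscillation hu hp θ 0).unique ?_
  convert! hasSum_fourier hu hp θ using 1
  funext n
  simp [mode, cutExp_of_ge (by norm_num : (-1 : ℝ) ≤ 0)]

theorem summable_abs_cutExp_mul_coeff (t : ℝ) :
    (Summable fun n : ℕ => |cutExp (rate n * t) * cosCoeff u₀ (n + 1)|) ∧
      Summable fun n : ℕ => |cutExp (rate n * t) * sinCoeff u₀ (n + 1)| := by
  obtain ⟨C, hC⟩ := boundedDerivs_cutExp.bound 0
  simp only [iteratedDeriv_zero] at hC
  constructor
  · refine Summable.of_nonneg_of_le (fun n => abs_nonneg _) (fun n => ?_)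
      ((rapidDecay_cosCoeff hu hp).summable_abs.mul_left C)
    rw [abs_mul]
    gcongr
    exact hC _
  · refine Summable.of_nonneg_of_le (fun n => abs_nonneg _) (fun n => ?_)
      ((rapidDecay_sinCoeff hu hp).summable_abs.mul_left C)
    rw [abs_mul]
    gcongr
    exact hC _

theorem integral_oscillation (t : ℝ) :
    ∫ θ in (0 : ℝ)..2 * Real.pi, oscillation u₀ θ t = 0 :=
  integral_eq_zero_of_hasSum_mode (summable_abs_cutExp_mul_coeff hu hp t).1
    (summable_abs_cutExp_mul_coeff hu hp t).2 fun θ => hasSum_oscillation hu hp θ t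

theorem hasSum_energy (t : ℝ) :
    HasSum (fun n : ℕ => Real.pi * ((cutExp (rate n * t) * cosCoeff u₀ (n + 1)) ^ 2
      + (cutExp (rate n * t) * sinCoeff u₀ (n + 1)) ^ 2)) (energy u₀ t) :=
  hasSum_sq_of_hasSum_mode (summable_abs_cutExp_mul_coeff hu hp t).1
    (summable_abs_cutExp_mul_coeff hu hp t).2 (fun θ => hasSum_oscillation hu hp θ t)
    (contDiff_oscillation_angle hu hp t).continuous

/-- By Parseval at times `0` and `t`, the sum under the stated square root is an energy loss, which
identifies `meanSq` with `a₀(t)²`. -/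
theorem hasSum_energy_sub {t : ℝ} (ht : 0 ≤ t) :
    HasSum (fun n : ℕ => (1 - Real.exp (2 * (1 - ((n : ℝ) + 1) ^ 2) * t)) *
      (cosCoeff u₀ (n + 1) ^ 2 + sinCoeff u₀ (n + 1) ^ 2))
      ((energy u₀ 0 - energy u₀ t) / Real.pi) := by
  have h := ((hasSum_energy hu hp 0).sub (hasSum_energy hu hp t)).div_const Real.pi
  convert! h using 1
  funext n
  have hπ := Real.pi_ne_zero
  have h1 : Real.exp (2 * (1 - ((n : ℝ) + 1) ^ 2) * t) = cutExp (rate n * t) ^ 2 := by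
    rw [cutExp_of_ge (by linarith [mul_nonneg (rate_nonneg n) ht]), ← Real.exp_nat_mul]
    congr 1
    simp only [rate]
    push_cast
    ring
  rw [h1, mul_zero, cutExp_of_ge (by norm_num : (-1 : ℝ) ≤ 0), neg_zero, Real.exp_zero]
  field_simp

theorem deriv_oscillation_time (θ : ℝ) {t : ℝ} (ht : 0 ≤ t) :
    deriv (fun s => oscillation u₀ θ s) t = radius (fun α => oscillation u₀ α t) θ := by
  have ha := rapidDecay_cosCoeff hu hp
  have hb := rapidDecay_sinCoeff hu hp
  have c1 : ContDiff ℝ ∞ (fun p : ℝ × ℝ => modeSeries cutExp Real.cos _ p.1 p.2) :=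
    contDiff_modeSeries boundedDerivs_cutExp boundedDerivs_cos ha
  have c2 : ContDiff ℝ ∞ (fun p : ℝ × ℝ => modeSeries cutExp Real.sin _ p.1 p.2) :=
    contDiff_modeSeries boundedDerivs_cutExp boundedDerivs_sin hb
  have h1 := (hasDerivAt_modeSeries_time boundedDerivs_cutExp boundedDerivs_cos ha θ t)
  have h2 := (hasDerivAt_modeSeries_time boundedDerivs_cutExp boundedDerivs_sin hb θ t)
  have e1 := modeSeries_heat boundedDerivs_cos (fun x => by simp) ha θ ht
  have e2 := modeSeries_heat boundedDerivs_sin (fun x => by simp) hb θ ht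
  have h3 : deriv (fun s => oscillation u₀ θ s) t = _ := (h1.add h2).deriv
  rw [h3, ← h1.deriv, ← h2.deriv, e1, e2]
  exact (radius_add (c1.comp (contDiff_id.prodMk contDiff_const))
    (c2.comp (contDiff_id.prodMk contDiff_const)) θ).symm

theorem contDiff_energy : ContDiff ℝ ∞ (energy u₀) :=
  contDiff_integral_param (f := fun θ t => oscillation u₀ θ t ^ 2)
    ((contDiff_oscillation hu hp).pow 2) _ _

theorem hasDerivAt_energy {t : ℝ} (ht : 0 ≤ t) :
    HasDerivAt (energy u₀) (2 * ∫ θ in (0 : ℝ)..2 * Real.pi,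
      oscillation u₀ θ t * radius (fun α => oscillation u₀ α t) θ) t := by
  have h := hasDerivAt_integral_param (f := fun θ t => oscillation u₀ θ t ^ 2)
    ((contDiff_oscillation hu hp).pow 2) 0 (2 * Real.pi) t
  convert! h using 1
  rw [← intervalIntegral.integral_const_mul]
  refine intervalIntegral.integral_congr fun θ _ => ?_
  have h1 := hasDerivAt_snd (contDiff_oscillation hu hp) θ t
  have h2 := (h1.pow 2).deriv
  have h3 : deriv (fun s => oscillation u₀ θ s ^ 2) t = _ := h2
  rw [h3, ← h1.deriv, deriv_oscillation_time hu hp θ ht]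
  simp
  ring

theorem contDiff_meanSq : ContDiff ℝ ∞ (meanSq u₀) :=
  contDiff_const.add (contDiff_const.mul
    ((contDiff_const.sub (contDiff_energy hu hp)).div_const Real.pi))

theorem hasDerivAt_meanSq {t : ℝ} (ht : 0 ≤ t) :
    HasDerivAt (meanSq u₀) (-(4 / Real.pi) * ∫ θ in (0 : ℝ)..2 * Real.pi,
      oscillation u₀ θ t * radius (fun α => oscillation u₀ α t) θ) t := by
  have h := ((((hasDerivAt_energy hu hp ht).const_sub (energy u₀ 0)).div_const Real.pi).const_mul
    2).const_add (cosCoeff u₀ 0 ^ 2)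
  convert! h using 1
  ring

end

/-- The support function of the solution, for times at which `meanSq` is positive. -/
noncomputable def supportSolution (u₀ : ℝ → ℝ) (θ t : ℝ) : ℝ :=
  Real.sqrt (meanSq u₀ t) / 2 + oscillation u₀ θ t

section
include hu hp

theorem radius_supportSolution (t θ : ℝ) :
    radius (fun α => supportSolution u₀ α t) θ
      = Real.sqrt (meanSq u₀ t) / 2 + radius (fun α => oscillation u₀ α t) θ :=
  radius_const_add (contDiff_oscillation_angle hu hp t) _ θ

theorem integral_supportSolution (t : ℝ) :
    ∫ α in (0 : ℝ)..2 * Real.pi, supportSolution u₀ α t = Real.pi * Real.sqrt (meanSq u₀ t) := by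
  simp only [supportSolution]
  rw [intervalIntegral.integral_add intervalIntegrable_const
    ((contDiff_oscillation_angle hu hp t).continuous.intervalIntegrable _ _),
    integral_oscillation hu hp, intervalIntegral.integral_const, smul_eq_mul]
  ring

/-- The cross terms vanish, since the oscillation and its radius both have mean zero. -/
theorem integral_supportSolution_mul_radius {t : ℝ} (hq : 0 ≤ meanSq u₀ t) :
    ∫ α in (0 : ℝ)..2 * Real.pi,
        supportSolution u₀ α t * radius (fun β => supportSolution u₀ β t) α
      = Real.pi / 2 * meanSq u₀ t + ∫ θ in (0 : ℝ)..2 * Real.pi,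
        oscillation u₀ θ t * radius (fun α => oscillation u₀ α t) θ := by
  have hw := contDiff_oscillation_angle hu hp t
  have hwc : Continuous fun θ => oscillation u₀ θ t := hw.continuous
  have hrc : Continuous (radius fun α => oscillation u₀ α t) := (contDiff_radius hw).continuous
  have hr0 : ∫ θ in (0 : ℝ)..2 * Real.pi, radius (fun α => oscillation u₀ α t) θ = 0 := by
    rw [integral_radius hw (periodic_oscillation hu hp t), integral_oscillation hu hp]
  set k := Real.sqrt (meanSq u₀ t) / 2 with hk
  have e : ∀ α, supportSolution u₀ α t * radius (fun β => supportSolution u₀ β t) α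
      = ((k ^ 2 + k * oscillation u₀ α t) + k * radius (fun α => oscillation u₀ α t) α)
        + oscillation u₀ α t * radius (fun α => oscillation u₀ α t) α := fun α => by
    rw [radius_supportSolution hu hp, supportSolution, ← hk]; ring
  simp only [e]
  rw [intervalIntegral.integral_add (Continuous.intervalIntegrable (by fun_prop) _ _)
    (Continuous.intervalIntegrable (by fun_prop) _ _),
    intervalIntegral.integral_add (Continuous.intervalIntegrable (by fun_prop) _ _)
    (Continuous.intervalIntegrable (by fun_prop) _ _),
    intervalIntegral.integral_add (Continuous.intervalIntegrable (by fun_prop) _ _)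
    (Continuous.intervalIntegrable (by fun_prop) _ _),
    intervalIntegral.integral_const_mul, intervalIntegral.integral_const_mul, hr0,
    integral_oscillation hu hp, intervalIntegral.integral_const, hk, div_pow, Real.sq_sqrt hq,
    smul_eq_mul]
  ring

/-- The evolution equation of the support function. -/
theorem hasDerivAt_supportSolution (θ : ℝ) {t : ℝ} (ht : 0 ≤ t) (hq : 0 < meanSq u₀ t) :
    HasDerivAt (fun s => supportSolution u₀ θ s)
      (radius (fun α => supportSolution u₀ α t) θ
        - (∫ α in (0 : ℝ)..2 * Real.pi,
            supportSolution u₀ α t * radius (fun β => supportSolution u₀ β t) α)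
          / (∫ α in (0 : ℝ)..2 * Real.pi, supportSolution u₀ α t)) t := by
  have h1 := ((hasDerivAt_meanSq hu hp ht).sqrt hq.ne').div_const 2
  have h2 := hasDerivAt_snd (contDiff_oscillation hu hp) θ t
  have h3 := h1.add h2
  rw [← h2.deriv, deriv_oscillation_time hu hp θ ht] at h3
  convert! h3 using 1
  -- With `k = √(meanSq)` and `I` the integral of the oscillation times its radius, the nonlocal
  -- term is `(π k² / 2 + I) / (π k)`. Its first part cancels the constant `k / 2` in the radius,
  -- and `-I / (π k)` is the derivative of `k / 2`.
  rw [integral_supportSolution hu hp, integral_supportSolution_mul_radius hu hp hq.le,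
    radius_supportSolution hu hp]
  have hs : 0 < Real.sqrt (meanSq u₀ t) := Real.sqrt_pos.2 hq
  have hsq : meanSq u₀ t = Real.sqrt (meanSq u₀ t) ^ 2 := (Real.sq_sqrt hq.le).symm
  set k := Real.sqrt (meanSq u₀ t)
  rw [hsq]
  have hπ := Real.pi_ne_zero
  field_simp
  ring

theorem supportSolution_zero (h0 : 0 ≤ cosCoeff u₀ 0) (θ : ℝ) :
    supportSolution u₀ θ 0 = u₀ θ := by
  have : meanSq u₀ 0 = cosCoeff u₀ 0 ^ 2 := by simp [meanSq]
  rw [supportSolution, this, Real.sqrt_sq h0, oscillation_zero hu hp]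
  ring

/-- The Fourier representation of the solution. -/
theorem isFourierSolution_supportSolution (T : ℝ) :
    IsFourierSolution u₀ T (supportSolution u₀) := fun t ht => by
  refine ⟨_, hasSum_energy_sub hu hp ht.1, fun θ => ?_⟩
  have e : supportSolution u₀ θ t - Real.sqrt (cosCoeff u₀ 0 ^ 2
      + 2 * ((energy u₀ 0 - energy u₀ t) / Real.pi)) / 2 = oscillation u₀ θ t := by
    rw [supportSolution, meanSq]; ring
  rw [e]
  convert! hasSum_oscillation hu hp θ t using 1
  funext n
  rw [mode, cutExp_of_ge (by linarith [mul_nonneg (rate_nonneg n) ht.1])]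
  have : (1 - ((n : ℝ) + 1) ^ 2) * t = -(rate n * t) := by rw [rate]; ring
  rw [this]
  ring

/-- Positivity at time zero persists uniformly in `θ` by compactness of a period. The time interval
is two-sided so that time can be cut off smoothly inside it. -/
theorem exists_time_radius_pos (hρ : ∀ θ, 0 < radius u₀ θ) (h0 : 0 < cosCoeff u₀ 0) :
    ∃ δ > 0, ∀ t, |t| < δ → 0 < meanSq u₀ t ∧
      ∀ θ, 0 < radius (fun α => supportSolution u₀ α t) θ := by
  have hqc : Continuous (meanSq u₀) := (contDiff_meanSq hu hp).continuous
  have hq0 : 0 < meanSq u₀ 0 := by simp [meanSq]; positivity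
  have hrc : Continuous fun p : ℝ × ℝ => radius (fun α => supportSolution u₀ α p.1) p.2 := by
    simp only [radius_supportSolution hu hp]
    have hW := contDiff_oscillation hu hp
    have h3 : Continuous fun p : ℝ × ℝ => radius (fun α => oscillation u₀ α p.1) p.2 := by
      generalize oscillation u₀ = f at hW
      exact (contDiff_radius_param hW).continuous.comp (continuous_snd.prodMk continuous_fst)
    have h4 : Continuous fun p : ℝ × ℝ => Real.sqrt (meanSq u₀ p.1) / 2 :=
      (Real.continuous_sqrt.comp (hqc.comp continuous_fst)).div_const 2
    exact h4.add h3
  have hr0 : ∀ θ, 0 < radius (fun α => supportSolution u₀ α 0) θ := fun θ => by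
    rw [funext fun α => supportSolution_zero hu hp h0.le α]; exact hρ θ
  have hev : ∀ᶠ t in 𝓝 (0 : ℝ), ∀ θ ∈ Icc (0 : ℝ) (2 * Real.pi),
      0 < radius (fun α => supportSolution u₀ α t) θ :=
    isCompact_Icc.eventually_forall_of_forall_eventually fun θ _ =>
      (hrc.tendsto (0, θ)).eventually (lt_mem_nhds (hr0 θ))
  obtain ⟨δ, hδ, h⟩ := Metric.eventually_nhds_iff.1
    (((hqc.tendsto 0).eventually (lt_mem_nhds hq0)).and hev)
  refine ⟨δ, hδ, fun t ht => ?_⟩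
  have h1 := h (y := t) (by simpa [Real.dist_eq] using ht)
  refine ⟨h1.1, fun θ => ?_⟩
  have hper : Function.Periodic (radius fun α => supportSolution u₀ α t) (2 * Real.pi) :=
    periodic_radius fun θ => by
      simp only [supportSolution, periodic_oscillation hu hp t θ]
  obtain ⟨θ', hθ', e⟩ := hper.exists_mem_Ico₀ Real.two_pi_pos θ
  rw [e]
  exact h1.2 θ' (Ico_subset_Icc_self hθ')

end

/-- Composing with `τ` keeps the family within the times of positive radius and freezes it for large
`|t|`, without altering it near zero. -/
theorem exists_time_cutoff {δ : ℝ} (hδ : 0 < δ) : ∃ τ : ℝ → ℝ, ContDiff ℝ ∞ τ ∧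
    (∀ t, |τ t| < δ) ∧ (∀ t, |t| < δ / 2 → τ t = t) ∧ ∀ t, δ ≤ |t| → τ t = 0 := by
  let f : ContDiffBump (0 : ℝ) := ⟨δ / 2, δ, by positivity, by linarith⟩
  have hz : ∀ t, δ ≤ |t| → f t = 0 := fun t ht =>
    f.zero_of_le_dist (by simpa [Real.dist_eq] using! ht)
  refine ⟨fun t => t * f t, contDiff_id.mul f.contDiff, fun t => ?_, fun t ht => ?_,
    fun t ht => by simp only [hz t ht, mul_zero]⟩
  · rcases le_or_gt δ |t| with h | h
    · simpa [hz t h] using hδ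
    · rw [abs_mul, abs_of_nonneg f.nonneg]
      exact lt_of_le_of_lt (mul_le_of_le_one_right (abs_nonneg t) f.le_one) h
  · have : f t = 1 := f.one_of_mem_closedBall (by
      simpa [Real.dist_eq] using! ht.le)
    simp only [this, mul_one]

theorem integral_support_pos (hu : ContDiff ℝ ∞ u₀) (hp : Function.Periodic u₀ (2 * Real.pi))
    (hρ : ∀ θ, 0 < radius u₀ θ) : 0 < ∫ α in (0 : ℝ)..2 * Real.pi, u₀ α := by
  rw [← integral_radius hu hp]
  exact intervalIntegral.intervalIntegral_pos_of_pos
    ((contDiff_radius hu).continuous.intervalIntegrable _ _) hρ Real.two_pi_pos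

/-- The support function flow, extended to a smooth family over all times. -/
theorem exists_support_evolution (hu : ContDiff ℝ ∞ u₀)
    (hp : Function.Periodic u₀ (2 * Real.pi)) (hρ : ∀ θ, 0 < radius u₀ θ) :
    ∃ T R : ℝ, 0 < T ∧ ∃ U : ℝ → ℝ → ℝ, ContDiff ℝ ∞ (fun p : ℝ × ℝ => U p.1 p.2) ∧
      (∀ t, Function.Periodic (fun θ => U θ t) (2 * Real.pi)) ∧
      (∀ t θ, 0 < radius (fun α => U α t) θ) ∧ (∀ θ, U θ 0 = u₀ θ) ∧
      (∀ t, R ≤ |t| → ∀ θ, U θ t = U θ 0) ∧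
      (∀ θ, ∀ t ∈ Ico 0 T, HasDerivAt (fun s => U θ s)
        (radius (fun α => U α t) θ
          - (∫ α in (0 : ℝ)..2 * Real.pi, U α t * radius (fun β => U β t) α)
            / (∫ α in (0 : ℝ)..2 * Real.pi, U α t)) t) ∧
      IsFourierSolution u₀ T U := by
  have h0 : 0 < cosCoeff u₀ 0 := by
    have := integral_support_pos hu hp hρ
    simp only [cosCoeff, Nat.cast_zero, zero_mul, Real.cos_zero, mul_one]
    positivity
  obtain ⟨δ, hδ, hpos⟩ := exists_time_radius_pos hu hp hρ h0
  obtain ⟨τ, hτ, hτδ, hτid, hτ0⟩ := exists_time_cutoff hδ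
  have hτz : τ 0 = 0 := hτid 0 (by simpa using hδ)
  have hT : ∀ t ∈ Ico 0 (δ / 2), |t| < δ / 2 := fun t ht => by rw [abs_of_nonneg ht.1]; exact ht.2
  -- Before `δ / 2` the cut-off time is the true time; from `δ` on it is zero.
  refine ⟨δ / 2, δ, by positivity, fun θ t => supportSolution u₀ θ (τ t), ?_, fun t θ => ?_,
    fun t θ => (hpos _ (hτδ t)).2 θ, fun θ => ?_, fun t ht θ => ?_, fun θ t ht => ?_,
    fun t ht => ?_⟩
  · have h1 : ContDiff ℝ ∞ (fun p : ℝ × ℝ => Real.sqrt (meanSq u₀ (τ p.2))) :=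
      ((contDiff_meanSq hu hp).comp (hτ.comp contDiff_snd)).sqrt
        fun p => (hpos _ (hτδ p.2)).1.ne'
    exact (h1.div_const 2).add
      ((contDiff_oscillation hu hp).comp (contDiff_fst.prodMk (hτ.comp contDiff_snd)))
  · simp only [supportSolution, periodic_oscillation hu hp (τ t) θ]
  · beta_reduce
    rw [hτz, supportSolution_zero hu hp h0.le]
  · beta_reduce
    rw [hτ0 t ht, hτz]
  · have hev : (fun s => supportSolution u₀ θ (τ s)) =ᶠ[𝓝 t] fun s => supportSolution u₀ θ s := by
      filter_upwards [(continuous_abs.tendsto t).eventually (gt_mem_nhds (hT t ht))] with s hs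
      rw [hτid s hs]
    beta_reduce
    rw [hτid t (hT t ht)]
    refine (hasDerivAt_supportSolution hu hp θ ht.1 ?_).congr_of_eventuallyEq hev
    have := (hpos _ (hτδ t)).1
    rwa [hτid t (hT t ht)] at this
  · simp only [hτid t (hT t ht)]
    exact isFourierSolution_supportSolution hu hp _ t ht

end Evolution

/-! ### Motion of the normal angle along the flow. -/

theorem exists_bound_of_periodic {G : ℝ → ℝ → ℝ} {R : ℝ}
    (hG : Continuous fun p : ℝ × ℝ => G p.1 p.2)
    (hp : ∀ t, Function.Periodic (fun θ => G θ t) (2 * Real.pi))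
    (hR : ∀ t, R ≤ |t| → ∀ θ, G θ t = G θ 0) : ∃ M : NNReal, ∀ θ t, |G θ t| ≤ M := by
  obtain ⟨M, hM⟩ := ((isCompact_Icc (a := (0 : ℝ)) (b := 2 * Real.pi)).prod
    (isCompact_Icc (a := -|R|) (b := |R|))).exists_bound_of_continuousOn hG.continuousOn
  have key : ∀ θ, ∀ t, |t| ≤ |R| → |G θ t| ≤ M := fun θ t ht => by
    obtain ⟨θ', hθ', e⟩ := (hp t).exists_mem_Ico₀ Real.two_pi_pos θ
    have e' : G θ t = G θ' t := e
    rw [e', ← Real.norm_eq_abs]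
    exact hM (θ', t) ⟨Ico_subset_Icc_self hθ', abs_le.1 ht⟩
  refine ⟨M.toNNReal, fun θ t => le_trans ?_ (Real.le_coe_toNNReal M)⟩
  rcases le_total R |t| with h | h
  · rw [hR t h]
    exact key θ 0 (by simp)
  · exact key θ t (h.trans (le_abs_self R))

/-- The speed of the normal angle along the flow, chosen such that the curve moves in the normal
direction. -/
noncomputable def angleSpeed (U : ℝ → ℝ → ℝ) (x t : ℝ) : ℝ :=
  -deriv (radius fun α => U α t) x / radius (fun α => U α t) x

section AngleFlow

variable {U : ℝ → ℝ → ℝ}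

theorem contDiff_angleSpeed (hU : ContDiff ℝ ∞ (fun p : ℝ × ℝ => U p.1 p.2))
    (hρ : ∀ t θ, 0 < radius (fun α => U α t) θ) :
    ContDiff ℝ ∞ (fun p : ℝ × ℝ => angleSpeed U p.1 p.2) := by
  have h1 := contDiff_radius_param hU
  have h2 : ContDiff ℝ ∞ (fun p : ℝ × ℝ => deriv (radius fun α => U α p.2) p.1) :=
    contDiff_deriv_fst (f := fun x t => radius (fun α => U α t) x) h1
  exact h2.neg.div h1 fun p => (hρ p.2 p.1).ne'

theorem periodic_angleSpeed (hp : ∀ t, Function.Periodic (fun θ => U θ t) (2 * Real.pi)) (t : ℝ) :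
    Function.Periodic (fun x => angleSpeed U x t) (2 * Real.pi) := fun x => by
  simp only [angleSpeed]
  rw [periodic_radius (hp t) x, periodic_deriv (periodic_radius (hp t)) x]

theorem angleSpeed_congr {t s : ℝ} (h : ∀ θ, U θ t = U θ s) (x : ℝ) :
    angleSpeed U x t = angleSpeed U x s := by
  simp only [angleSpeed, funext h]

/-- The flow of the normal angle. -/
theorem exists_angle_flow {R : ℝ} (hU : ContDiff ℝ ∞ (fun p : ℝ × ℝ => U p.1 p.2))
    (hp : ∀ t, Function.Periodic (fun θ => U θ t) (2 * Real.pi))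
    (hρ : ∀ t θ, 0 < radius (fun α => U α t) θ) (hR : ∀ t, R ≤ |t| → ∀ θ, U θ t = U θ 0) :
    ∃ Θ : ℝ → ℝ → ℝ, ContDiff ℝ ∞ (fun p : ℝ × ℝ => Θ p.1 p.2) ∧ (∀ x, Θ x 0 = x) ∧
      (∀ x t, HasDerivAt (fun s => Θ x s) (angleSpeed U (Θ x t) t) t) ∧
      (∀ x t, 0 < deriv (fun y => Θ y t) x) ∧
      ∀ x t, Θ (x + 2 * Real.pi) t = Θ x t + 2 * Real.pi := by
  have hF := contDiff_angleSpeed hU hρ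
  have hFp := periodic_angleSpeed hp
  obtain ⟨M, hM⟩ := exists_bound_of_periodic hF.continuous hFp
    fun t ht => angleSpeed_congr (hR t ht)
  obtain ⟨K, hK⟩ := exists_bound_of_periodic (R := R)
    (G := fun x t => deriv (fun y => angleSpeed U y t) x) (contDiff_deriv_fst hF).continuous
    (fun t => periodic_deriv (hFp t))
    (fun t ht x => by simp only [angleSpeed_congr (hR t ht)])
  obtain ⟨Θ, hΘ, h0, hd, hpos, huniq⟩ := exists_smooth_flow hF hK hM
  refine ⟨Θ, hΘ, h0, hd, hpos, fun x t => ?_⟩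
  -- A trajectory shifted by a period is again a trajectory, so uniqueness makes the flow commute
  -- with the shift.
  refine (congrFun (huniq (x + 2 * Real.pi) (fun t => Θ x t + 2 * Real.pi) (by simp [h0])
    fun t => ?_) t).symm
  have e : angleSpeed U (Θ x t + 2 * Real.pi) t = angleSpeed U (Θ x t) t := hFp t _
  rw [e]
  exact (hd x t).add_const _

theorem isAngle_comp_flow {Θ : ℝ → ℝ → ℝ} {ε : ℝ} {θ : ℝ → ℝ} (hθ : IsAngle ε θ) {t : ℝ}
    (hΘ : ContDiff ℝ ∞ fun x => Θ x t) (hpos : ∀ x, 0 < deriv (fun y => Θ y t) x)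
    (hadd : ∀ x, Θ (x + 2 * Real.pi) t = Θ x t + 2 * Real.pi) :
    IsAngle ε fun φ => Θ (θ φ) t where
  sign := hθ.sign
  smooth := hΘ.comp hθ.smooth
  deriv_pos φ := by
    have h : HasDerivAt (fun φ => Θ (θ φ) t) _ φ :=
      (hasDerivAt_of_contDiff hΘ (θ φ)).comp φ (hasDerivAt_of_contDiff hθ.smooth φ)
    rw [h.deriv, mul_left_comm]
    exact mul_pos (hpos _) (hθ.deriv_pos φ)
  add_period φ := by
    rw [hθ.add_period]
    rcases hθ.sign with h | h
    · rw [h, one_mul, hadd]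
    · rw [h]
      have := hadd (θ φ + -1 * (2 * Real.pi))
      rw [show θ φ + -1 * (2 * Real.pi) + 2 * Real.pi = θ φ by ring] at this
      rw [this]
      ring

/-- If the support function moves with normal speed `radius - c` and the angle with `angleSpeed`,
then the point moves in the normal direction. -/
theorem hasDerivAt_point_flow (hU : ContDiff ℝ ∞ (fun p : ℝ × ℝ => U p.1 p.2)) {t c : ℝ}
    (hρ : ∀ θ, 0 < radius (fun α => U α t) θ)
    (hUt : ∀ θ, HasDerivAt (fun s => U θ s) (radius (fun α => U α t) θ - c) t) {x : ℝ → ℝ}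
    (hx : HasDerivAt x (angleSpeed U (x t) t) t) :
    HasDerivAt (fun s => point (fun α => U α s) (x s))
      ((radius (fun α => U α t) (x t) - c) • dir (x t)) t := by
  have hP : HasFDerivAt (fun p : ℝ × ℝ => U p.1 p.2) _ (x t, t) :=
    (hU.differentiable (by simp) (x t, t)).hasFDerivAt
  have hV := contDiff_deriv_fst hU
  have hQ : HasFDerivAt (fun p : ℝ × ℝ => deriv (fun y => U y p.2) p.1) _ (x t, t) :=
    (hV.differentiable (by simp) (x t, t)).hasFDerivAt
  have hc : HasDerivAt (fun s => (x s, s)) (angleSpeed U (x t) t, 1) t :=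
    hx.prodMk (hasDerivAt_id t)
  have split : ∀ (A : ℝ × ℝ →L[ℝ] ℝ) (a : ℝ), A (a, 1) = a * A (1, 0) + A (0, 1) := fun A a => by
    rw [show ((a, 1) : ℝ × ℝ) = a • (1, 0) + (0, 1) by simp, map_add, map_smul, smul_eq_mul]
  have h1 : HasDerivAt (fun s => U (x s) s) _ t := hP.comp_hasDerivAt (f := fun s => (x s, s)) t hc
  have h2 : HasDerivAt (fun s => deriv (fun y => U y s) (x s)) _ t :=
    hQ.comp_hasDerivAt (f := fun s => (x s, s)) t hc
  -- Mixed derivatives commute and `c` does not depend on the angle, so the time derivative of `U_θ`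
  -- is the angle derivative of the radius.
  have m : deriv (fun s => deriv (fun y => U y s) (x t)) t
      = deriv (radius fun α => U α t) (x t) := by
    rw [deriv_deriv_comm hU]
    simp only [fun y => (hUt y).deriv]
    exact deriv_sub_const _
  rw [split, ← (hasDerivAt_fst hU (x t) t).deriv, ← (hasDerivAt_snd hU (x t) t).deriv,
    (hUt (x t)).deriv] at h1
  rw [split, ← (hasDerivAt_fst (f := fun x t => deriv (fun y => U y t) x) hV (x t) t).deriv,
    ← (hasDerivAt_snd (f := fun x t => deriv (fun y => U y t) x) hV (x t) t).deriv, m] at h2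
  have d1 : HasDerivAt (fun s => dir (x s)) _ t := (hasDerivAt_dir (x t)).scomp t hx
  have d2 : HasDerivAt (fun s => rot (dir (x s))) _ t := (hasDerivAt_rot_dir (x t)).scomp t hx
  convert! (h1.smul d1).add (h2.smul d2) using 1
  have hne := (hρ (x t)).ne'
  have e : deriv (fun y => deriv (fun y => U y t) y) (x t)
      = radius (fun α => U α t) (x t) - U (x t) t := by
    simp [radius]
  -- The tangential velocity is `x' ρ + ρ'`, which this choice of `x'` makes zero; along the normal
  -- the terms `x' U_θ` cancel and `U_t` remains.
  have e2 : deriv (radius fun α => U α t) (x t)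
      = -(angleSpeed U (x t) t * radius (fun α => U α t) (x t)) := by
    rw [angleSpeed, div_mul_cancel₀ _ hne, neg_neg]
  rw [e, e2]
  module

end AngleFlow

theorem contDiff_point_flow {U Θ : ℝ → ℝ → ℝ} {θ : ℝ → ℝ}
    (hU : ContDiff ℝ ∞ (fun p : ℝ × ℝ => U p.1 p.2))
    (hΘ : ContDiff ℝ ∞ (fun p : ℝ × ℝ => Θ p.1 p.2)) (hθ : ContDiff ℝ ∞ θ) :
    ContDiff ℝ ∞ fun p : ℝ × ℝ => point (fun α => U α p.2) (Θ (θ p.1) p.2) := by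
  have h : ContDiff ℝ ∞ fun p : ℝ × ℝ => Θ (θ p.1) p.2 :=
    hΘ.comp ((hθ.comp contDiff_fst).prodMk contDiff_snd)
  have h1 : ContDiff ℝ ∞ fun p : ℝ × ℝ => U (Θ (θ p.1) p.2) p.2 :=
    hU.comp (h.prodMk contDiff_snd)
  have h2 : ContDiff ℝ ∞ fun p : ℝ × ℝ => deriv (fun α => U α p.2) (Θ (θ p.1) p.2) :=
    (contDiff_deriv_fst hU).comp (h.prodMk contDiff_snd)
  have h3 : ContDiff ℝ ∞ fun p : ℝ × ℝ => dir (Θ (θ p.1) p.2) := contDiff_dir.comp h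
  exact (h1.smul h3).add (h2.smul (rotCLM.contDiff.comp h3))

end DualFlow

/-! ### Assembly of the solution. -/

open DualFlow in
theorem mainTheorem9 (X₀ : ℝ → DualFlow.Plane) (hX₀ : DualFlow.IsStrictlyConvexCurve X₀) :
    ∃ T : ℝ, 0 < T ∧ ∃ X : ℝ → ℝ → DualFlow.Plane,
      DualFlow.IsSmoothConvexSolution X₀ T X ∧
      DualFlow.IsSupportSolution T (fun θ t => DualFlow.supportFun (fun φ => X φ t) θ) ∧
      DualFlow.IsFourierSolution (DualFlow.supportFun X₀) T
        (fun θ t => DualFlow.supportFun (fun φ => X φ t) θ) := by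
  obtain ⟨hu, hp, hρ, ε, θ, hθ, hX⟩ := hX₀.exists_support
  obtain ⟨T, R, hT, U, hU, hUp, hUρ, hU0, hUR, hUt, hUF⟩ := exists_support_evolution hu hp hρ
  obtain ⟨Θ, hΘ, hΘ0, hΘt, hΘpos, hΘadd⟩ := exists_angle_flow hU hUp hUρ hUR
  have hUs : ∀ t, ContDiff ℝ ∞ fun α => U α t := fun t =>
    hU.comp (contDiff_id.prodMk contDiff_const)
  have hang : ∀ t, IsAngle ε fun φ => Θ (θ φ) t := fun t =>
    isAngle_comp_flow hθ (hΘ.comp (contDiff_id.prodMk contDiff_const)) (fun x => hΘpos x t)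
      fun x => hΘadd x t
  have hsupp : (fun α t => supportFun (fun φ => point (fun α => U α t) (Θ (θ φ) t)) α) = U := by
    funext α t
    exact congrFun (supportFun_curve (hUs t) (hUp t) (hUρ t) (hang t)) α
  refine ⟨T, hT, fun φ t => point (fun α => U α t) (Θ (θ φ) t), ?_, ?_, ?_⟩
  · refine ⟨(contDiff_point_flow hU hΘ hθ.smooth).contDiffOn, fun t _ =>
      isStrictlyConvexCurve_curve (hUs t) (hUp t) (hUρ t) (hang t), fun φ => ?_,
      fun φ t ht => ?_⟩
    · simp only [hΘ0, hU0]
      exact (hX φ).symm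
    · beta_reduce
      rw [area_curve (hUs t) (hUp t) (hUρ t) (hang t),
        length_curve (hUs t) (hUp t) (hUρ t) (hang t),
        curvature_curve (hUs t) (hUp t) (hUρ t) (hang t),
        inwardNormal_curve (hUs t) (hUp t) (hUρ t) (hang t)]
      convert! (hasDerivAt_point_flow hU (hUρ t) (fun α => hUt α t ht)
        (hΘt (θ φ) t)).hasDerivWithinAt using 1
      -- Here `1 / k` is the radius and `2A / L` is the nonlocal term; the sign changes because the
      -- inward normal is `-dir`.
      rw [one_div_one_div, smul_neg, ← neg_smul]
      congr 1
      ring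
  · rw [hsupp]
    exact ⟨hU.contDiffOn, fun t _ => hUp t, fun t _ => hUρ t,
      fun t _ => integral_support_pos (hUs t) (hUp t) (hUρ t),
      fun α t ht => (hUt α t ht).hasDerivWithinAt⟩
  · rw [hsupp]
    exact hUF
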